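/- Let $0<\mu<1$, $\alpha=\frac{1+\mu}{2\mu}$, $\delta=\frac{1-\mu}{2\mu}$, let $N\ge 1$ and $\nu\ge 0$ be integers, and let $I_\kappa$, $K_\kappa$ denote the modified Bessel functions of the first and second kind. For $x>0$ and $j\ge 0$ put $$\psi_j(x)=x^{j/2}I_j(2\delta\sqrt x),\qquad \varphi_j(x)=x^{(j+\nu)/2}K_{j+\nu}(2\alpha\sqrt x),$$ $$g_{k,l}=\int_0^\infty \psi_l(x)\varphi_k(x)\,dx\quad(0\le k,l\le N-1),\qquad (c_{k,l})_{k,l=0}^{N-1}=\big((g_{k,l})_{k,l=0}^{N-1}\big)^{-1},$$ and let $$K_N(x,y)=\sum_{k,l=0}^{N-1}c_{k,l}\,\psi_k(x)\,\varphi_l(y)$$ be the correlation kernel of the biorthogonal ensemble on $(0,\infty)^N$ with joint density proportional to $\det[\psi_{j-1}(y_i)]_{i,j=1}^N\det[\varphi_{j-1}(y_i)]_{i,j=1}^N$. Let $\Sigma$ be a closed piecewise $C^1$ contour in $\mathbb C$ that encircles $0,1,\dots,N-1$ once in the positive direction (it avoids these points and has winding number $1$ about each of them), and let $c>0$ be such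 that $\Sigma$ does not meet any of the lines $\operatorname{Re} t=c-1+j$, $j=0,1,\dots,N-1$. Then for all $x,y>0$ $$K_N(x,y)=\sum_{k=0}^{N-1}K_N^{(k)}(x,y)\left(\frac{\delta}{\alpha}\right)^{2k},$$ where $$\begin{aligned}K_N^{(k)}(x,y)=\sum_{m=0}^{k}\frac{(-1)^m}{(2\pi i)^2}\binom{N}{m}\oint_\Sigma dt\int_{c-i\infty}^{c+i\infty}ds\;&\frac{\Gamma(s)^2\,\Gamma(s+\nu+k)\,\Gamma(s-t+m-1)\,\Gamma(t-N+1)}{\Gamma(t+1)^2\,\Gamma(t+\nu+1)\,\Gamma(s-N+m)\,\Gamma(s-t+k)}\\ &\times\Big(1-\frac{\delta^2}{\alpha^2}\Big)^{\nu}(\alpha^2-\delta^2)^{t+1}\,x^{t}\;{}_0F_1\!\left(\begin{matrix}-\\ t+1\end{matrix}\,\Big|\,\delta^2x\right)(\alpha^2y)^{-s},\end{aligned}$$ and all these integrals over $s$ and $t$ converge absolutely. (At points where the integrand has a removable singularity it may be given any value.) -/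

import Mathlib

open scoped Nat

noncomputable section

namespace CoupledGaussian

/-! ### Parameters, Bessel functions and the correlation kernel -/

/-- `α(μ) = (1 + μ) / (2 μ)`. -/
def alpha (μ : ℝ) : ℝ := (1 + μ) / (2 * μ)

/-- `δ(μ) = (1 - μ) / (2 μ)`. -/
def delta (μ : ℝ) : ℝ := (1 - μ) / (2 * μ)

/-- The modified Bessel function of the first kind `I_κ` of order `κ = 0, 1, 2, …`. -/
def besselI (κ : ℕ) (z : ℝ) : ℝ :=
  ∑' m : ℕ, 1 / ((m ! : ℝ) * Real.Gamma (κ + m + 1)) * (z / 2) ^ (2 * m + κ)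

/-- The modified Bessel function of the second kind `K_κ` of order `κ = 0, 1, 2, …` at `z > 0`,
by the absolutely convergent integral
`K_κ(z) = (1/2) (z/2)^κ ∫_0^∞ exp(-t - z²/(4t)) t^{-κ-1} dt`. -/
def besselK (κ : ℕ) (z : ℝ) : ℝ :=
  1 / 2 * (z / 2) ^ κ *
    ∫ t in Set.Ioi (0 : ℝ), Real.exp (-t - z ^ 2 / (4 * t)) / t ^ (κ + 1)

/-- `ψ_j(x) = x^{j/2} I_j(2 δ(μ) √x)`. -/
def psi (μ : ℝ) (j : ℕ) (x : ℝ) : ℝ :=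
  x ^ ((j : ℝ) / 2) * besselI j (2 * delta μ * √x)

/-- `φ_j(x) = x^{(j+ν)/2} K_{j+ν}(2 α(μ) √x)`. -/
def phi (ν : ℕ) (μ : ℝ) (j : ℕ) (x : ℝ) : ℝ :=
  x ^ (((j : ℝ) + ν) / 2) * besselK (j + ν) (2 * alpha μ * √x)

/-- The matrix `g_{k,l} = ∫_0^∞ ψ_l(x) φ_k(x) dx`, `0 ≤ k, l ≤ N - 1`. -/
def gramMatrix (N ν : ℕ) (μ : ℝ) : Matrix (Fin N) (Fin N) ℝ :=
  Matrix.of fun k l => ∫ x in Set.Ioi (0 : ℝ), psi μ l x * phi ν μ k x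

/-- The correlation kernel `K_N(x,y) = ∑_{k,l} c_{k,l} ψ_k(x) φ_l(y)`, where `(c_{k,l})` is the
inverse of the matrix `(g_{k,l})`, of the biorthogonal ensemble on `(0,∞)^N` whose joint density is
proportional to `det[ψ_{j-1}(y_i)] det[φ_{j-1}(y_i)]`. -/
def correlationKernel (N ν : ℕ) (μ : ℝ) (x y : ℝ) : ℝ :=
  ∑ k : Fin N, ∑ l : Fin N, (gramMatrix N ν μ)⁻¹ k l * psi μ k x * phi ν μ l y

/-! ### Contour integrals -/

/-- A path is piecewise `C¹` if `[0,1]` splits into finitely many closed intervals on each of which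
it is continuously differentiable (with one-sided derivatives at the end points). -/
def IsPiecewiseC1 {p q : ℂ} (γ : Path p q) : Prop :=
  ∃ (n : ℕ) (τ : ℕ → ℝ), Monotone τ ∧ τ 0 = 0 ∧ τ n = 1 ∧
    ∀ i < n, ContDiffOn ℝ 1 γ.extend (Set.Icc (τ i) (τ (i + 1)))

/-- The `ℂ`-linear form `f(t) dt`. -/
def oneForm (f : ℂ → ℂ) (t : ℂ) : ℂ →L[ℂ] ℂ :=
  ContinuousLinearMap.toSpanSingleton ℂ (f t)

/-- `∫_γ f(t) dt`. -/
def contourIntegral {p q : ℂ} (γ : Path p q) (f : ℂ → ℂ) : ℂ :=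
  curveIntegral (oneForm f) γ

/-- The winding number `(2πi)⁻¹ ∮_γ dt / (t - z)` of a closed path about a point off the path. -/
def windingNumber {p : ℂ} (γ : Path p p) (z : ℂ) : ℂ :=
  (2 * Real.pi * Complex.I)⁻¹ * contourIntegral γ fun t => (t - z)⁻¹

/-- The closed path `γ` encircles the point `z` once in the positive direction. -/
def EncirclesOnce {p : ℂ} (γ : Path p p) (z : ℂ) : Prop :=
  z ∉ Set.range γ ∧ windingNumber γ z = 1

/-- The integral `∫_{c-i∞}^{c+i∞} f(s) ds`. -/
def verticalIntegral (c : ℝ) (f : ℂ → ℂ) : ℂ :=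
  Complex.I * ∫ v : ℝ, f (c + v * Complex.I)

/-! ### The integrand -/

/-- The hypergeometric function `₀F₁(-; b | z) = ∑_n z^n / ((b)_n n!)`. -/
def hyp0F1 (b z : ℂ) : ℂ :=
  ∑' n : ℕ, z ^ n / ((ascPochhammer ℂ n).eval b * (n ! : ℂ))

/-- The integrand of the double contour integral. -/
def kernelIntegrand (N ν : ℕ) (μ : ℝ) (k m : ℕ) (x y : ℝ) (t s : ℂ) : ℂ :=
  Complex.Gamma s ^ 2 * Complex.Gamma (s + ν + k) * Complex.Gamma (s - t + m - 1)
      * Complex.Gamma (t - N + 1)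
    / (Complex.Gamma (t + 1) ^ 2 * Complex.Gamma (t + ν + 1) * Complex.Gamma (s - N + m)
      * Complex.Gamma (s - t + k))
    * ((1 - delta μ ^ 2 / alpha μ ^ 2 : ℝ) : ℂ) ^ ν
    * ((alpha μ ^ 2 - delta μ ^ 2 : ℝ) : ℂ) ^ (t + 1)
    * (x : ℂ) ^ t
    * hyp0F1 (t + 1) ((delta μ ^ 2 * x : ℝ) : ℂ)
    * ((alpha μ ^ 2 * y : ℝ) : ℂ) ^ (-s)

/-- `K_N^{(k)}(x,y)`, for the closed contour `γ` in `t` and the line `Re s = c`. -/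
def kernelCoeff (N ν : ℕ) (μ : ℝ) {p : ℂ} (γ : Path p p) (c : ℝ) (k : ℕ) (x y : ℝ) : ℂ :=
  ∑ m ∈ Finset.range (k + 1),
    (-1) ^ m / (2 * Real.pi * Complex.I) ^ 2 * (N.choose m : ℂ) *
      contourIntegral γ fun t =>
        verticalIntegral c fun s => kernelIntegrand N ν μ k m x y t s

end CoupledGaussian

end

/-!
Write `q = δ² / α²`. Up to constants and scaling, `φ_κ(x)` is the inverse Mellin transform of
`Γ(s) Γ(s + κ)`, and integrating the power series of `ψ_j` against such a function term by term
gives sums of the form `∑ i, ((i + j + ν)! / i!) q^(i + j) P(i + j + 1)`. For the polynomial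
`P(s) = ∑ k < N, q^k (s + ν)_k R_k(s - 1)`, with `R_k` the polynomial `residuePoly K N n k`, the
coefficient of `q^M` is a multiple of a concomitant of two falling factorials for the `N`-th
difference operator. Summation by parts shows that this concomitant does not depend on its base
point, and it vanishes unless `j = n`. Hence the Mellin–Barnes integrals with polynomial factor `P`
are, up to a constant, biorthogonal to `ψ_0, …, ψ_{N-1}`, and `K_N(x, y) = ∑ n, ψ_n(x) dual_n(y)`.

On the side of the double integral, the recurrence of `Γ` turns the quotients of Gamma functions
into falling factorials, so that in `t` the inner integral is a holomorphic function times
`∏_{j < N} (t - j)⁻¹` on each component of the complement of the lines `Re t = c - 1 + j`. The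
contour lies in one such component, and so do the points it encircles. The residue at `t = n`
contains the factor `ψ_n(x)`, and the sum over `m` of the remaining `s`-integrands has the
polynomial factor `(s + ν)_k R_k(s - 1)` of the dual function.
-/

noncomputable section

namespace CoupledGaussian

open Polynomial Finset

/-! ### Falling factorials -/

section Falling

variable {R : Type*} [CommRing R]

/-- The falling factorial `a (a - 1) ⋯ (a - r + 1)`, as a function on a commutative ring. -/
def falling (r : ℕ) (a : R) : R := (descPochhammer R r).eval a

@[simp] theorem falling_zero (a : R) : falling 0 a = 1 := by simp [falling]

theorem falling_eq_prod (r : ℕ) (a : R) : falling r a = ∏ i ∈ range r, (a - i) :=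
  descPochhammer_eval_eq_prod_range r a

theorem falling_succ (r : ℕ) (a : R) : falling (r + 1) a = falling r a * (a - r) :=
  descPochhammer_succ_eval r a

theorem falling_succ_left (r : ℕ) (a : R) : falling (r + 1) a = a * falling r (a - 1) := by
  simp [falling, descPochhammer_succ_left, eval_comp]

theorem falling_add (r s : ℕ) (a : R) : falling (r + s) a = falling r a * falling s (a - r) := by
  simp [falling, ← descPochhammer_mul, eval_comp]

theorem falling_succ_add_one (r : ℕ) (a : R) :
    falling (r + 1) (a + 1) = falling (r + 1) a + (r + 1) * falling r a := by
  rw [falling_succ_left, falling_succ, add_sub_cancel_right]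
  ring

theorem falling_natCast_of_lt {a r : ℕ} (h : a < r) : falling r (a : R) = 0 :=
  descPochhammer_eval_coe_nat_of_lt h

theorem falling_natCast (a r : ℕ) : falling r (a : R) = a.descFactorial r :=
  descPochhammer_eval_eq_descFactorial R a r

theorem falling_neg_one (r : ℕ) : falling r (-1 : R) = (-1) ^ r * r ! := by
  induction r with
  | zero => simp
  | succ r ih =>
    rw [falling_succ, ih, Nat.factorial_succ]
    push_cast
    ring

theorem falling_add_natCast_ne_zero [IsDomain R] {k : ℕ} {a : R}
    (ha : ∀ i < k, a + i + 1 ≠ 0) : falling k (a + k) ≠ 0 := by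
  rw [falling_eq_prod, prod_ne_zero_iff]
  intro i hi h
  rw [mem_range] at hi
  refine ha (k - 1 - i) (by omega) ?_
  rw [← h, Nat.cast_sub (by omega), Nat.cast_sub (by omega)]
  push_cast
  ring

theorem falling_mul_falling (a : R) {N n k m : ℕ} (hn : n < N) (hk : k < N) (hm : m ≤ k) :
    falling k (a + k) * falling (N - m) a =
      falling n (a + k) * falling (k - m + 1) (a + k - n) *
        falling (N - 1 - n) (a - n - 1 + m) := by
  have h_left := falling_add k (N - m) (a + k)
  have h_right := falling_add (n + (k - m + 1)) (N - 1 - n) (a + k)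
  rw [show n + (k - m + 1) + (N - 1 - n) = k + (N - m) by omega, h_left, add_sub_cancel_right,
    falling_add n (k - m + 1)] at h_right
  rw [h_right]
  congr 2
  push_cast [Nat.cast_sub hm]
  ring

theorem falling_mul_falling_eq_zero {d n j k m : ℕ} (hnj : n ≤ j) (hk : k ≤ d) (hm : m ≤ k)
    (hne : ¬(k = d - n ∧ m = 0 ∧ j = n)) :
    falling j ((d : R) - k) * falling (d - n) ((d : R) - k + m - (n + 1)) = 0 := by
  rw [← Nat.cast_sub hk]
  by_cases hj : d - k < j
  · rw [falling_natCast_of_lt hj, zero_mul]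
  · have h_lt : d - k + m - (n + 1) < d - n := by omega
    rw [← Nat.cast_add, ← Nat.cast_succ, ← Nat.cast_sub (by omega),
      falling_natCast_of_lt h_lt, mul_zero]

/-! ### Alternating binomial sums -/

theorem sum_alternating_choose_mul_eval {p : R[X]} {N : ℕ} (hp : p.natDegree < N) (x : R) :
    ∑ m ∈ range (N + 1), (-1) ^ m * (N.choose m : R) * p.eval (x + m) = 0 := by
  have h := congr_arg ((-1) ^ N * ·) (congr_fun (fwdDiff_iter_eq_zero_of_degree_lt hp) x)
  simp only [fwdDiff_iter_eq_sum_shift, mul_sum, Pi.zero_apply, mul_zero] at h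
  rw [← h]
  refine sum_congr rfl fun m hm => ?_
  have h_sign : (-1 : R) ^ N * (-1) ^ (N - m) = (-1) ^ m := by
    obtain ⟨d, rfl⟩ := Nat.exists_eq_add_of_le (mem_range_succ_iff.1 hm)
    rw [Nat.add_sub_cancel_left, pow_add, mul_assoc, ← mul_pow]
    simp
  simp only [zsmul_eq_mul, nsmul_eq_mul, mul_one]
  push_cast
  rw [← h_sign]
  ring

variable [IsDomain R]

theorem natDegree_descPochhammer_comp_X_add_C (r : ℕ) (u : R) :
    ((descPochhammer R r).comp (X + C u)).natDegree = r := by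
  rw [natDegree_comp, descPochhammer_natDegree, natDegree_X_add_C, mul_one]

theorem sum_alternating_choose_mul_falling_add {r N : ℕ} (hr : r < N) (x : R) :
    ∑ m ∈ range (N + 1), (-1) ^ m * (N.choose m : R) * falling r (x + m) = 0 :=
  sum_alternating_choose_mul_eval (by rwa [descPochhammer_natDegree]) x

theorem sum_alternating_choose_mul_falling_sub {r N : ℕ} (hr : r < N) (x : R) :
    ∑ m ∈ range (N + 1), (-1) ^ m * (N.choose m : R) * falling r (x - m) = 0 := by
  have h := sum_alternating_choose_mul_eval (p := (descPochhammer R r).comp (-X)) (N := N)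
    (by rwa [natDegree_comp, natDegree_neg, natDegree_X, mul_one, descPochhammer_natDegree]) (-x)
  rw [← h]
  refine sum_congr rfl fun m _ => ?_
  rw [falling, eval_comp, eval_neg, eval_X, neg_add_rev, neg_neg, neg_add_eq_sub]

end Falling

/-! ### The bilinear concomitant of two falling factorials -/

section Concomitant

variable {R : Type*} [CommRing R]

/-- The bilinear concomitant of the falling factorials `x^{\underline j}` and
`(x - u)^{\underline r}` for the `N`-th difference operator, based at `M`: summation by parts shows
that it does not depend on `M`. -/
def concomitant (N j r : ℕ) (u M : R) : R :=
  ∑ k ∈ range N, ∑ m ∈ range (k + 1),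
    (-1) ^ m * (N.choose m : R) * falling j (M - k) * falling r (M - k + m - u)

variable [IsDomain R]

theorem concomitant_add_one {N j r : ℕ} (hj : j < N) (hr : r < N) (u M : R) :
    concomitant N j r u (M + 1) = concomitant N j r u M := by
  let c : ℕ → R := fun m => (-1) ^ m * (N.choose m : R)
  set W : ℕ → R := fun k => ∑ m ∈ range (k + 1),
    c m * falling j (M + 1 - k) * falling r (M + 1 - k + m - u) with hW
  have h_shifted : concomitant N j r u (M + 1) = ∑ k ∈ range N, W k := rfl
  have h_base : concomitant N j r u M = ∑ k ∈ range N,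
      (W (k + 1) - c (k + 1) * falling j (M + 1 - (k + 1 : ℕ)) * falling r (M + 1 - u)) := by
    refine sum_congr rfl fun k _ => ?_
    rw [hW]
    dsimp only
    rw [sum_range_succ _ (k + 1), sub_add_cancel, add_sub_cancel_right, Nat.cast_succ,
      add_sub_add_right_eq_sub]
  have h_top : W N = 0 := by
    rw [← mul_zero (falling j (M + 1 - N)),
      ← sum_alternating_choose_mul_falling_add hr (M + 1 - N - u), mul_sum]
    refine sum_congr rfl fun m _ => ?_
    rw [show M + 1 - (N : R) + m - u = M + 1 - N - u + m by ring]
    ring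
  have h_bottom : W 0 + ∑ k ∈ range N,
      c (k + 1) * falling j (M + 1 - (k + 1 : ℕ)) * falling r (M + 1 - u) = 0 := by
    have h := sum_alternating_choose_mul_falling_sub hj (M + 1)
    rw [sum_range_succ', Nat.cast_zero, sub_zero] at h
    rw [← sum_mul]
    simp only [hW, zero_add, sum_range_one, Nat.cast_zero, sub_zero, add_zero]
    linear_combination h * falling r (M + 1 - u)
  have h_telescope := sum_range_sub W N
  rw [sum_sub_distrib] at h_telescope h_base
  linear_combination h_shifted - h_base + h_bottom - h_telescope - h_top

theorem concomitant_shift {N j r : ℕ} (hj : j + 1 < N) (hr : r + 1 < N) (u M : R) :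
    (j + 1) * concomitant N j (r + 1) (u - 1) M + (r + 1) * concomitant N (j + 1) r u M = 0 := by
  rw [← sub_eq_zero.2 (concomitant_add_one hj hr u M)]
  simp only [concomitant, mul_sum, ← sum_add_distrib, ← sum_sub_distrib]
  refine sum_congr rfl fun k _ => sum_congr rfl fun m _ => ?_
  rw [show M + 1 - (k : R) = M - k + 1 by ring, falling_succ_add_one,
    show M - (k : R) + 1 + m - u = M - k + m - u + 1 by ring,
    show M - (k : R) + m - (u - 1) = M - k + m - u + 1 by ring, falling_succ_add_one]
  ring

theorem concomitant_natCast {N j r : ℕ} (hj : j < N) (hr : r < N) (u : R) (M : ℕ) :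
    concomitant N j r u M = concomitant N j r u 0 := by
  induction M with
  | zero => simp
  | succ M ih => rw [Nat.cast_succ, concomitant_add_one hj hr, ih]

variable [CharZero R]

theorem concomitant_zero_right {N j : ℕ} (hj : j + 1 < N) (u M : R) :
    concomitant N j 0 u M = 0 := by
  have h : (j + 1 : R) * concomitant N j 0 u M = 0 := by
    rw [← sub_eq_zero.2 (concomitant_add_one hj (Nat.zero_lt_of_lt hj) u M)]
    simp only [concomitant, mul_sum, ← sum_sub_distrib]
    refine sum_congr rfl fun k _ => sum_congr rfl fun m _ => ?_
    rw [show M + 1 - (k : R) = M - k + 1 by ring, falling_succ_add_one]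
    simp only [falling_zero]
    ring
  exact (mul_eq_zero.1 h).resolve_left (Nat.cast_add_one_ne_zero j)

theorem concomitant_eq_zero {N r : ℕ} :
    ∀ {j : ℕ}, j + r + 1 < N → ∀ u M : R, concomitant N j r u M = 0 := by
  induction r with
  | zero => exact fun h u M => concomitant_zero_right (by omega) u M
  | succ r ih =>
    intro j h u M
    have h_shift := concomitant_shift (N := N) (j := j) (r := r) (by omega) (by omega) (u + 1) M
    rw [ih (by omega), mul_zero, add_zero, add_sub_cancel_right] at h_shift
    exact (mul_eq_zero.1 h_shift).resolve_left (Nat.cast_add_one_ne_zero j)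

theorem concomitant_falling {N n j : ℕ} (hn : n < N) (hj : j < N) (M : ℕ) :
    concomitant N j (N - 1 - n) (n + 1 : R) M =
      if j = n then (-1) ^ (N - 1 - n) * (n ! * (N - 1 - n)! : R) else 0 := by
  rcases lt_or_ge j n with h | h
  · rw [if_neg h.ne, concomitant_eq_zero (by omega)]
  have hr : N - 1 - n < N := by omega
  rw [concomitant_natCast hj hr, ← concomitant_natCast hj hr _ (N - 1), concomitant]
  have h_vanish : ∀ k ∈ range N, ∀ m ∈ range (k + 1), ¬(k = N - 1 - n ∧ m = 0 ∧ j = n) →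
      (-1) ^ m * (N.choose m : R) * falling j (((N - 1 : ℕ) : R) - k) *
        falling (N - 1 - n) (((N - 1 : ℕ) : R) - k + m - (n + 1)) = 0 := by
    intro k hk m hm hne
    rw [mem_range] at hk
    rw [mul_assoc, falling_mul_falling_eq_zero h (by omega) (mem_range_succ_iff.1 hm) hne, mul_zero]
  split_ifs with hjn
  · subst hjn
    have h_mem : N - 1 - j ∈ range N := by rw [mem_range]; omega
    rw [sum_eq_single_of_mem _ h_mem fun k hk hne =>
        sum_eq_zero fun m hm => h_vanish k hk m hm (hne ·.1),
      sum_eq_single_of_mem 0 (by simp) fun m hm hne => h_vanish _ h_mem m hm (hne ·.2.1),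
      ← Nat.cast_sub (by omega), Nat.sub_sub_self (by omega), falling_natCast,
      Nat.descFactorial_self, Nat.cast_zero, add_zero, sub_add_cancel_left, falling_neg_one]
    simp only [pow_zero, Nat.choose_zero_right, Nat.cast_one]
    ring
  · exact sum_eq_zero fun k hk => sum_eq_zero fun m hm => h_vanish k hk m hm (hjn ·.2.2)

end Concomitant

/-! ### The polynomials that arise from the residues -/

section ResiduePoly

variable (K : Type*) [Field K]

/-- The polynomial `∑_{m ≤ k} (-1)^m C(N, m) (a - n - 1 + m)^{\underline{N - 1 - n}}` in `a`. For
`k = N` the sum would be the `N`-th difference of a polynomial of smaller degree, hence zero. -/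
def partialSumPoly (N n k : ℕ) : K[X] :=
  ∑ m ∈ range (k + 1), C ((-1) ^ m * (N.choose m : K)) *
    (descPochhammer K (N - 1 - n)).comp (X + C ((m : K) - n - 1))

/-- The polynomial `R` with
`∑_{m ≤ k} (-1)^m C(N, m) a^{\underline{N - m}} / ∏_{m ≤ j ≤ k} (a - n + j) = R(a)`, encoded as a
quotient of polynomials whose division is exact for `n, k < N`. -/
def residuePoly (N n k : ℕ) : K[X] :=
  (descPochhammer K n).comp (X + C (k : K)) * partialSumPoly K N n k /ₘ
    ∏ i ∈ range k, (X - C (-((i + 1 : ℕ) : K)))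

variable {K}

theorem eval_partialSumPoly (N n k : ℕ) (a : K) :
    (partialSumPoly K N n k).eval a = ∑ m ∈ range (k + 1),
      (-1) ^ m * (N.choose m : K) * falling (N - 1 - n) (a - n - 1 + m) := by
  simp only [partialSumPoly, eval_finsetSum, eval_mul, eval_C, eval_comp, eval_add, eval_X, falling]
  refine sum_congr rfl fun m _ => ?_
  congr 2
  ring

theorem eval_partialSumPoly_neg {N n k b : ℕ} (hn : n < N) (hk : k < N) (hb : 1 ≤ b)
    (hbk : b + n ≤ k) : (partialSumPoly K N n k).eval (-(b : K)) = 0 := by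
  have h := sum_alternating_choose_mul_falling_add (r := N - 1 - n) (N := N) (by omega)
    (-(b : K) - n - 1)
  rw [eval_partialSumPoly, ← h]
  refine sum_subset (range_subset_range.2 (by omega)) fun m hm hm' => ?_
  rw [mem_range] at hm hm'
  have h_cast : -(b : K) - n - 1 + m = (m - (b + n + 1) : ℕ) := by
    rw [Nat.cast_sub (by omega)]
    push_cast
    ring
  rw [h_cast, falling_natCast_of_lt (by omega), mul_zero]

theorem eval_prod_X_sub_C_neg_succ (k : ℕ) (a : K) :
    (∏ i ∈ range k, (X - C (-((i + 1 : ℕ) : K)))).eval a = falling k (a + k) := by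
  rw [eval_prod, falling_eq_prod, ← prod_range_reflect]
  refine prod_congr rfl fun i hi => ?_
  rw [mem_range] at hi
  rw [eval_sub, eval_X, eval_C, show k - 1 - i + 1 = k - i by omega, Nat.cast_sub hi.le]
  ring

theorem monic_prod_X_sub_C_neg_succ {k : ℕ} :
    (∏ i ∈ range k, (X - C (-((i + 1 : ℕ) : K)))).Monic :=
  monic_prod_of_monic _ _ fun _ _ => monic_X_sub_C _

theorem degree_residuePoly {N n k : ℕ} (hn : n < N) (hk : k < N) :
    (residuePoly K N n k).degree < (N - k : ℕ) := by
  have h_divisor : (∏ i ∈ range k, (X - C (-((i + 1 : ℕ) : K)))).natDegree = k := by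
    rw [natDegree_prod_of_monic _ _ fun i _ => monic_X_sub_C _]
    simp only [natDegree_X_sub_C, sum_const, card_range, smul_eq_mul, mul_one]
  have h_partialSum : (partialSumPoly K N n k).natDegree ≤ N - 1 - n :=
    natDegree_sum_le_of_forall_le _ _ fun m _ =>
      (natDegree_C_mul_le _ _).trans (natDegree_descPochhammer_comp_X_add_C _ _).le
  have h_dividend := natDegree_mul_le.trans
    (add_le_add (natDegree_descPochhammer_comp_X_add_C n (k : K)).le h_partialSum)
  refine degree_le_natDegree.trans_lt (Nat.cast_lt.2 ?_)
  rw [residuePoly, natDegree_divByMonic _ monic_prod_X_sub_C_neg_succ, h_divisor]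
  omega

variable [CharZero K]

theorem prod_X_sub_C_neg_succ_dvd {N n k : ℕ} (hn : n < N) (hk : k < N) :
    ∏ i ∈ range k, (X - C (-((i + 1 : ℕ) : K))) ∣
      (descPochhammer K n).comp (X + C (k : K)) * partialSumPoly K N n k := by
  have h_inj : Function.Injective fun i : ℕ => -((i + 1 : ℕ) : K) := fun a b hab => by
    simpa using hab
  refine Finset.prod_dvd_of_coprime
    (fun i _ j _ hij => pairwise_coprime_X_sub_C h_inj hij) fun i hi => ?_
  rw [mem_range] at hi
  rw [dvd_iff_isRoot, IsRoot.def, eval_mul, eval_comp, eval_add, eval_X, eval_C]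
  by_cases h : k - (i + 1) < n
  · have h_falling : falling n ((k - (i + 1) : ℕ) : K) = 0 := falling_natCast_of_lt h
    rw [neg_add_eq_sub, ← Nat.cast_sub (by omega), ← falling, h_falling, zero_mul]
  · rw [eval_partialSumPoly_neg hn hk (by omega) (by omega), mul_zero]

theorem eval_residuePoly_mul {N n k : ℕ} (hn : n < N) (hk : k < N) (a : K) :
    (residuePoly K N n k).eval a * falling k (a + k) =
      falling n (a + k) * (partialSumPoly K N n k).eval a := by
  have h_mod := (modByMonic_eq_zero_iff_dvd monic_prod_X_sub_C_neg_succ).2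
    (prod_X_sub_C_neg_succ_dvd (K := K) hn hk)
  have h_div := modByMonic_add_div ((descPochhammer K n).comp (X + C (k : K)) *
    partialSumPoly K N n k) (∏ i ∈ range k, (X - C (-((i + 1 : ℕ) : K))))
  rw [h_mod, zero_add, ← residuePoly] at h_div
  have h_eval := congr_arg (eval a) h_div
  rw [eval_mul, eval_mul, eval_prod_X_sub_C_neg_succ, eval_comp, eval_add, eval_X, eval_C] at h_eval
  rw [mul_comm, h_eval, falling]

theorem eval_residuePoly {N n k : ℕ} (hn : n < N) (hk : k < N) {a : K}
    (ha : ∀ i < k, a + i + 1 ≠ 0) (hne : ∀ j ≤ k, a - n + j ≠ 0) :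
    (residuePoly K N n k).eval a = ∑ m ∈ range (k + 1), (-1) ^ m * (N.choose m : K) *
      (falling (N - m) a * (falling (k - m + 1) (a + k - n))⁻¹) := by
  refine mul_right_cancel₀ (falling_add_natCast_ne_zero ha) ?_
  rw [eval_residuePoly_mul hn hk, eval_partialSumPoly, mul_sum, sum_mul]
  refine sum_congr rfl fun m hm => ?_
  have hm' : m ≤ k := mem_range_succ_iff.1 hm
  have h_ne : falling (k - m + 1) (a + k - n) ≠ 0 := by
    rw [falling_eq_prod, prod_ne_zero_iff]
    intro i hi h
    rw [mem_range] at hi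
    refine hne (k - i) (by omega) ?_
    rw [← h, Nat.cast_sub (by omega)]
    ring
  have h_split := falling_mul_falling a hn hk hm'
  field_simp
  linear_combination -h_split * (N.choose m : K)

theorem sum_falling_mul_residuePoly {N n j : ℕ} (hn : n < N) (hj : j < N) (M : ℕ) :
    ∑ k ∈ range N, falling (k + j) (M : K) * (residuePoly K N n k).eval ((M : K) - k) =
      if j = n then (-1) ^ (N - 1 - n) * (n ! * (N - 1 - n)! : K) * falling n (M : K) else 0 := by
  have h_concomitant :
      ∑ k ∈ range N, falling (k + j) (M : K) * (residuePoly K N n k).eval ((M : K) - k) =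
        concomitant N j (N - 1 - n) (n + 1 : K) M * falling n (M : K) := by
    rw [concomitant, sum_mul]
    refine sum_congr rfl fun k hk => ?_
    have h_eval := eval_residuePoly_mul hn (mem_range.1 hk) ((M : K) - k)
    rw [sub_add_cancel, eval_partialSumPoly] at h_eval
    rw [falling_add, mul_comm (falling k _), mul_assoc, mul_comm (falling k _), h_eval, mul_sum,
      mul_sum, sum_mul]
    refine sum_congr rfl fun m _ => ?_
    rw [show (M : K) - k - n - 1 + m = M - k + m - (n + 1) by ring]
    ring
  rw [h_concomitant, concomitant_falling hn hj M]
  split_ifs <;> simp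

end ResiduePoly

theorem exists_eq_sum_of_degree_lt {K : Type*} [Field K] (S : Polynomial.Sequence K) {N : ℕ}
    {p : K[X]} (hp : p.degree < N) : ∃ d : ℕ → K, p = ∑ l ∈ range N, C (d l) * S l := by
  have h_mem : p ∈ Submodule.span K (S '' Set.Iio N) := by
    rw [S.span_degreeLT fun i _ => (leadingCoeff_ne_zero.2 (S.ne_zero i)).isUnit]
    exact mem_degreeLT.2 hp
  obtain ⟨d, hd, rfl⟩ := (Finsupp.mem_span_image_iff_linearCombination K).1 h_mem
  refine ⟨d, ?_⟩
  rw [Finsupp.linearCombination_apply, Finsupp.sum_of_support_subset (s := range N)]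
  · simp only [smul_eq_C_mul]
  · exact fun i hi => mem_range.2 (hd hi)
  · simp

section MellinPoly

variable {K : Type*} [Field K]

/-- The polynomial `∑_k q^k (s + ν)_k R_k(s - 1)` in `s`, where `R_k` is `residuePoly K N n k`. It
is the polynomial factor of the Mellin transform of the function dual to `ψ_n`. -/
def mellinPoly (N ν n : ℕ) (q : K) : K[X] :=
  ∑ k ∈ range N, C (q ^ k) * (ascPochhammer K k).comp (X + C (ν : K)) *
    (residuePoly K N n k).comp (X - C 1)

theorem eval_mellinPoly (N ν n : ℕ) (q s : K) :
    (mellinPoly N ν n q).eval s = ∑ k ∈ range N,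
      q ^ k * (ascPochhammer K k).eval (s + ν) * (residuePoly K N n k).eval (s - 1) := by
  simp only [mellinPoly, eval_finsetSum, eval_mul, eval_C, eval_comp, eval_add, eval_sub, eval_X]

theorem natDegree_ascPochhammer_comp_X_add_C (l : ℕ) (a : K) :
    ((ascPochhammer K l).comp (X + C a)).natDegree = l := by
  rw [natDegree_comp, ascPochhammer_natDegree, natDegree_X_add_C, mul_one]

theorem degree_mellinPoly {N n : ℕ} (ν : ℕ) (q : K) (hn : n < N) :
    (mellinPoly N ν n q).degree < N := by
  rw [← mem_degreeLT]
  refine Submodule.sum_mem _ fun k hk => mem_degreeLT.2 ?_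
  rw [mem_range] at hk
  have h_residue := degree_residuePoly (K := K) hn hk
  by_cases h_zero : residuePoly K N n k = 0
  · rw [h_zero, zero_comp, mul_zero, degree_zero]
    exact WithBot.bot_lt_coe N
  · rw [degree_eq_natDegree h_zero, Nat.cast_lt] at h_residue
    have h_shift : ((residuePoly K N n k).comp (X - C 1)).natDegree < N - k := by
      rwa [natDegree_comp, natDegree_X_sub_C, mul_one]
    have h_mul := natDegree_mul_le.trans (add_le_add_left
      ((natDegree_C_mul_le (q ^ k) _).trans (natDegree_ascPochhammer_comp_X_add_C k (ν : K)).le)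
      ((residuePoly K N n k).comp (X - C 1)).natDegree)
    exact degree_le_natDegree.trans_lt (Nat.cast_lt.2 (by omega))

/-- The polynomials `(X + ν)_l`, as a sequence with one polynomial in each degree. -/
def ascPochhammerSequence (K : Type*) [Field K] (ν : ℕ) : Polynomial.Sequence K where
  elems' l := (ascPochhammer K l).comp (X + C (ν : K))
  degree_eq' l := by
    rw [degree_eq_natDegree, natDegree_ascPochhammer_comp_X_add_C]
    exact ((monic_ascPochhammer K l).comp (monic_X_add_C _)
      (by rw [natDegree_X_add_C]; exact one_ne_zero)).ne_zero

theorem exists_eval_mellinPoly_eq_sum {N n : ℕ} (ν : ℕ) (q : K) (hn : n < N) :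
    ∃ d : ℕ → K, ∀ s, (mellinPoly N ν n q).eval s =
      ∑ l ∈ range N, d l * (ascPochhammer K l).eval (s + ν) := by
  obtain ⟨d, hd⟩ := exists_eq_sum_of_degree_lt (ascPochhammerSequence K ν)
    (degree_mellinPoly ν q hn)
  refine ⟨d, fun s => ?_⟩
  rw [hd, eval_finsetSum]
  refine sum_congr rfl fun l _ => ?_
  simp only [ascPochhammerSequence, eval_mul, eval_C, eval_comp, eval_add, eval_X]

end MellinPoly

/-! ### Moments -/

section Moments

theorem hasSum_nat_add_iff_of_eq_zero {G : Type*} [AddCommGroup G] [TopologicalSpace G]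
    [IsTopologicalAddGroup G] {f : ℕ → G} {m : ℕ} (hf : ∀ i < m, f i = 0) {a : G} :
    HasSum (fun i => f (i + m)) a ↔ HasSum f a := by
  rw [hasSum_nat_add_iff, sum_eq_zero fun i hi => hf i (mem_range.1 hi), add_zero]

section Algebra

variable {K : Type*} [Field K]

/-- The value at `M = i + j + k` of this function is the `k`-th summand of
`q^(i + j) (i + j + ν)! / i ! * (mellinPoly N ν n q).eval (i + j + 1)`, and for fixed `M` the sum
over `k` is a multiple of a concomitant. -/
def momentTerm (N ν n j : ℕ) (q : K) (k M : ℕ) : K :=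
  q ^ M * (ascPochhammer K ν).eval ((M : K) + 1) *
    (falling (k + j) (M : K) * (residuePoly K N n k).eval ((M : K) - k))

theorem momentTerm_eq_zero_of_lt {N ν n j k M : ℕ} (q : K) (hM : M < k + j) :
    momentTerm N ν n j q k M = 0 := by
  rw [momentTerm, falling_natCast_of_lt hM, zero_mul, mul_zero]

variable [CharZero K]

theorem falling_add_natCast (i m : ℕ) : falling m ((i + m : ℕ) : K) = (i + m)! / i ! := by
  rw [falling_natCast, eq_div_iff (Nat.cast_ne_zero.2 i.factorial_ne_zero), mul_comm,
    ← Nat.factorial_mul_descFactorial (Nat.le_add_left m i), Nat.add_sub_cancel, Nat.cast_mul]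

theorem eval_ascPochhammer_natCast_add_one (M l : ℕ) :
    (ascPochhammer K l).eval ((M : K) + 1) = (M + l)! / M ! := by
  rw [eq_div_iff (Nat.cast_ne_zero.2 M.factorial_ne_zero), mul_comm, factorial_mul_ascPochhammer]

theorem sum_momentTerm (ν : ℕ) {N n j : ℕ} (hn : n < N) (hj : j < N) (q : K) (M : ℕ) :
    ∑ k ∈ range N, momentTerm N ν n j q k M =
      if j = n then (-1) ^ (N - 1 - n) * (n ! * (N - 1 - n)! : K) *
        (q ^ M * (ascPochhammer K ν).eval ((M : K) + 1) * falling n (M : K)) else 0 := by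
  simp only [momentTerm]
  rw [← mul_sum, sum_falling_mul_residuePoly hn hj]
  split_ifs <;> ring

theorem sum_momentTerm_shift (N ν n j : ℕ) (q : K) (i : ℕ) :
    ∑ k ∈ range N, momentTerm N ν n j q k (i + (k + j)) =
      q ^ (i + j) * ((i + j + ν)! / i ! * (mellinPoly N ν n q).eval ((i + j : ℕ) + 1 : K)) := by
  rw [eval_mellinPoly, mul_sum, mul_sum]
  refine sum_congr rfl fun k _ => ?_
  have h_factorial : ((i + j + ν)! : K) ≠ 0 := Nat.cast_ne_zero.2 (i + j + ν).factorial_ne_zero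
  have h_factorial' : ((i + (k + j))! : K) ≠ 0 := Nat.cast_ne_zero.2 (i + (k + j)).factorial_ne_zero
  have h_shift : ((i + j : ℕ) : K) + 1 + ν = ((i + j + ν : ℕ) : K) + 1 := by
    push_cast
    ring
  rw [momentTerm, falling_add_natCast, h_shift, eval_ascPochhammer_natCast_add_one,
    eval_ascPochhammer_natCast_add_one, show i + (k + j) + ν = i + j + ν + k by ring,
    show ((i + (k + j) : ℕ) : K) - k = (i + j : ℕ) + 1 - 1 by push_cast; ring,
    show q ^ (i + (k + j)) = q ^ (i + j) * q ^ k by ring]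
  field_simp

end Algebra

variable {𝕜 : Type*} [NormedField 𝕜]

theorem summable_eval_mul_geometric (P : 𝕜[X]) {q : 𝕜} (hq : ‖q‖ < 1) :
    Summable fun M : ℕ => P.eval (M : 𝕜) * q ^ M := by
  simp_rw [eval_eq_sum_range, sum_mul, mul_assoc]
  exact summable_sum fun i _ => (summable_pow_mul_geometric_of_norm_lt_one i hq).mul_left _

theorem summable_momentTerm (N ν n j : ℕ) {q : 𝕜} (hq : ‖q‖ < 1) (k : ℕ) :
    Summable (momentTerm N ν n j q k) := by
  refine (summable_eval_mul_geometric ((ascPochhammer 𝕜 ν).comp (X + C 1) *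
    descPochhammer 𝕜 (k + j) * (residuePoly 𝕜 N n k).comp (X - C (k : 𝕜))) hq).congr fun M => ?_
  simp only [momentTerm, eval_mul, eval_comp, eval_add, eval_X, eval_C, eval_sub, falling]
  ring

variable [CharZero 𝕜]

theorem hasSum_factorial_div_factorial_mul_geometric (r : ℕ) {q : 𝕜} (hq : ‖q‖ < 1) :
    HasSum (fun i : ℕ => ((i + r)! / i ! : 𝕜) * q ^ i) (r ! / (1 - q) ^ (r + 1)) := by
  have h := (hasSum_choose_mul_geometric_of_norm_lt_one r hq).mul_left (r ! : 𝕜)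
  rw [mul_one_div] at h
  refine h.congr_fun fun i => ?_
  have h_factorial : (i ! : 𝕜) ≠ 0 := Nat.cast_ne_zero.2 i.factorial_ne_zero
  rw [← Nat.add_choose_mul_factorial_mul_factorial i r]
  push_cast
  field_simp

theorem hasSum_falling_mul_geometric (ν n : ℕ) {q : 𝕜} (hq : ‖q‖ < 1) :
    HasSum (fun M : ℕ => q ^ M * (ascPochhammer 𝕜 ν).eval ((M : 𝕜) + 1) * falling n (M : 𝕜))
      (q ^ n * ((n + ν)! / (1 - q) ^ (n + ν + 1))) := by
  rw [← hasSum_nat_add_iff_of_eq_zero (m := n) fun i hi => by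
    rw [falling_natCast_of_lt hi, mul_zero]]
  refine ((hasSum_factorial_div_factorial_mul_geometric (n + ν) hq).mul_left (q ^ n)).congr_fun
    fun i => ?_
  have h_factorial : ((i + n)! : 𝕜) ≠ 0 := Nat.cast_ne_zero.2 (i + n).factorial_ne_zero
  rw [falling_add_natCast, eval_ascPochhammer_natCast_add_one, add_assoc i n ν, pow_add]
  field_simp

theorem hasSum_mellinPoly {N n j : ℕ} (ν : ℕ) (hn : n < N) (hj : j < N) {q : 𝕜} (hq : ‖q‖ < 1) :
    HasSum (fun i : ℕ => q ^ (i + j) *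
        ((i + j + ν)! / i ! * (mellinPoly N ν n q).eval ((i + j : ℕ) + 1 : 𝕜)))
      (if j = n then (-1) ^ (N - 1 - n) * (n ! * (N - 1 - n)! : 𝕜) *
        (q ^ n * ((n + ν)! / (1 - q) ^ (n + ν + 1))) else 0) := by
  have h_total : HasSum (fun M => ∑ k ∈ range N, momentTerm N ν n j q k M)
      (if j = n then (-1) ^ (N - 1 - n) * (n ! * (N - 1 - n)! : 𝕜) *
        (q ^ n * ((n + ν)! / (1 - q) ^ (n + ν + 1))) else 0) := by
    simp_rw [sum_momentTerm ν hn hj]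
    split_ifs
    · exact (hasSum_falling_mul_geometric ν n hq).mul_left _
    · exact hasSum_zero
  have h_sum := hasSum_sum fun k (_ : k ∈ range N) => (summable_momentTerm N ν n j hq k).hasSum
  rw [h_total.unique h_sum]
  simp_rw [← sum_momentTerm_shift]
  exact hasSum_sum fun k _ => (hasSum_nat_add_iff_of_eq_zero fun i hi =>
    momentTerm_eq_zero_of_lt q hi).2 (summable_momentTerm N ν n j hq k).hasSum

end Moments

end CoupledGaussian

end

noncomputable section

namespace CoupledGaussian

open MeasureTheory Set Filter Topology

/-! ### Contour integrals along piecewise `C¹` paths -/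

section ContourIntegral

variable {p q : ℂ} {γ : Path p q}

theorem curveIntegralFun_oneForm (γ : Path p q) (f : ℂ → ℂ) (t : ℝ) :
    curveIntegralFun (oneForm f) γ t = derivWithin γ.extend (Icc 0 1) t * f (γ.extend t) := by
  rw [curveIntegralFun_def, oneForm, ContinuousLinearMap.toSpanSingleton_apply, smul_eq_mul]

theorem extend_mem_range (γ : Path p q) (t : ℝ) : γ.extend t ∈ range γ :=
  γ.extend_range ▸ mem_range_self t

theorem IsPiecewiseC1.intervalIntegrable_derivWithin (hγ : IsPiecewiseC1 γ) :
    IntervalIntegrable (fun t => derivWithin γ.extend (Icc 0 1) t) volume 0 1 := by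
  obtain ⟨n, τ, hτ, hτ_zero, hτ_n, hτ_diff⟩ := hγ
  rw [← hτ_zero, ← hτ_n]
  refine IntervalIntegrable.trans_iterate fun k hk => ?_
  rcases (hτ (Nat.le_add_right k 1)).eq_or_lt with h | h
  · rw [h]
  have h_piece : IntervalIntegrable (derivWithin γ.extend (Icc (τ k) (τ (k + 1)))) volume
      (τ k) (τ (k + 1)) := by
    apply ContinuousOn.intervalIntegrable
    rw [uIcc_of_le h.le]
    exact (hτ_diff k hk).continuousOn_derivWithin (uniqueDiffOn_Icc h) le_rfl
  refine h_piece.congr_uIoo fun t ht => ?_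
  rw [uIoo_of_le h.le] at ht
  rw [derivWithin_of_mem_nhds (Icc_mem_nhds ht.1 ht.2), derivWithin_of_mem_nhds]
  exact Icc_mem_nhds ((hτ (Nat.zero_le k)).trans_lt ht.1) (ht.2.trans_le (hτ hk))

theorem IsPiecewiseC1.hasDerivAt_off_countable (hγ : IsPiecewiseC1 γ) :
    ∃ s : Set ℝ, s.Countable ∧ ∀ t ∈ Ioo (0 : ℝ) 1 \ s,
      HasDerivAt γ.extend (derivWithin γ.extend (Icc 0 1) t) t := by
  obtain ⟨n, τ, hτ, hτ_zero, hτ_n, hτ_diff⟩ := hγ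
  refine ⟨range τ, countable_range τ, fun t ⟨ht, htτ⟩ => ?_⟩
  obtain ⟨k, hkt, htk⟩ : ∃ k, τ k < t ∧ t < τ (k + 1) := by
    by_contra! h
    have h_lt : ∀ k, τ k < t := fun k => by
      induction k with
      | zero => exact hτ_zero ▸ ht.1
      | succ k ih => exact (h k ih).lt_of_ne fun h_eq => htτ ⟨k + 1, h_eq⟩
    exact (h_lt n).not_gt (hτ_n ▸ ht.2)
  have hkn : k < n := by
    by_contra! h
    exact ((hτ h).trans_lt hkt).not_gt (hτ_n ▸ ht.2)
  rw [derivWithin_of_mem_nhds (Icc_mem_nhds ht.1 ht.2)]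
  exact (((hτ_diff k hkn).differentiableOn one_ne_zero t ⟨hkt.le, htk.le⟩).differentiableAt
    (Icc_mem_nhds hkt htk)).hasDerivAt

theorem IsPiecewiseC1.curveIntegrable (hγ : IsPiecewiseC1 γ) {f : ℂ → ℂ}
    (hf : ContinuousOn f (range γ)) : CurveIntegrable (oneForm f) γ := by
  rw [CurveIntegrable, funext (curveIntegralFun_oneForm γ f)]
  exact hγ.intervalIntegrable_derivWithin.mul_continuousOn <|
    hf.comp γ.continuous_extend.continuousOn fun t _ => extend_mem_range γ t

theorem countable_setOf_eq_and_deriv_ne_zero (f : ℝ → ℂ) (z : ℂ) :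
    {t | f t = z ∧ deriv f t ≠ 0}.Countable := by
  set S := {t | f t = z ∧ deriv f t ≠ 0}
  have : DiscreteTopology S := by
    rw [discreteTopology_subtype_iff]
    rintro x ⟨-, hx⟩
    rw [← disjoint_iff, disjoint_principal_right]
    filter_upwards
      [(differentiableAt_of_deriv_ne_zero hx).hasDerivAt.eventually_ne hx (c := z)] with y hy hyS
    exact hy hyS.1
  exact countable_of_Lindelof_of_discrete (X := S)

/-- A path may stay at a point of `Z` for a set of times of positive measure, but its derivative
vanishes at almost all of these times. -/
theorem curveIntegralFun_congr_ae (γ : Path p q) {f g : ℂ → ℂ} {Z : Set ℂ}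
    (hZ : Z.Countable) (h : ∀ z ∈ range γ, z ∉ Z → f z = g z) :
    curveIntegralFun (oneForm f) γ =ᵐ[volume.restrict (uIoc 0 1)]
      curveIntegralFun (oneForm g) γ := by
  have h_countable : (⋃ z ∈ Z, {t | γ.extend t = z ∧ deriv γ.extend t ≠ 0}).Countable :=
    hZ.biUnion fun z _ => countable_setOf_eq_and_deriv_ne_zero _ z
  rw [uIoc_of_le zero_le_one, ← restrict_Ioo_eq_restrict_Ioc]
  filter_upwards [ae_restrict_mem measurableSet_Ioo, h_countable.ae_notMem _] with t ht ht_notMem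
  rw [curveIntegralFun_oneForm, curveIntegralFun_oneForm,
    derivWithin_of_mem_nhds (Icc_mem_nhds ht.1 ht.2)]
  by_cases hz : γ.extend t ∈ Z
  · have h_deriv : deriv γ.extend t = 0 :=
      by_contra fun hd => ht_notMem (mem_biUnion hz ⟨rfl, hd⟩)
    rw [h_deriv, zero_mul, zero_mul]
  · rw [h _ (extend_mem_range γ t) hz]

theorem curveIntegrable_congr {f g : ℂ → ℂ} {Z : Set ℂ}
    (hZ : Z.Countable) (h : ∀ z ∈ range γ, z ∉ Z → f z = g z)
    (hg : CurveIntegrable (oneForm g) γ) : CurveIntegrable (oneForm f) γ :=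
  IntervalIntegrable.congr_ae hg (curveIntegralFun_congr_ae γ hZ h).symm

theorem contourIntegral_congr {f g : ℂ → ℂ} {Z : Set ℂ}
    (hZ : Z.Countable) (h : ∀ z ∈ range γ, z ∉ Z → f z = g z) :
    contourIntegral γ f = contourIntegral γ g := by
  rw [contourIntegral, contourIntegral, curveIntegral_def, curveIntegral_def]
  exact intervalIntegral.integral_congr_ae_restrict (curveIntegralFun_congr_ae γ hZ h)

theorem contourIntegral_add {f g : ℂ → ℂ}
    (hf : CurveIntegrable (oneForm f) γ) (hg : CurveIntegrable (oneForm g) γ) :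
    contourIntegral γ (fun t => f t + g t) = contourIntegral γ f + contourIntegral γ g := by
  rw [contourIntegral, contourIntegral, contourIntegral, ← curveIntegral_add hf hg]
  congr 1
  ext t
  simp [oneForm]

theorem contourIntegral_const_mul (a : ℂ) (f : ℂ → ℂ) :
    contourIntegral γ (fun t => a * f t) = a * contourIntegral γ f := by
  rw [contourIntegral, contourIntegral, ← smul_eq_mul a (curveIntegral _ _), ← curveIntegral_smul]
  congr 1
  ext t
  simp [oneForm]

theorem contourIntegral_finset_sum {ι : Type*} (s : Finset ι)
    {f : ι → ℂ → ℂ} (hf : ∀ i ∈ s, CurveIntegrable (oneForm (f i)) γ) :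
    contourIntegral γ (fun t => ∑ i ∈ s, f i t) = ∑ i ∈ s, contourIntegral γ (f i) := by
  simp only [contourIntegral, curveIntegral_def]
  rw [← intervalIntegral.integral_finsetSum hf]
  congr 1
  ext t
  simp only [curveIntegralFun_oneForm, Finset.mul_sum]

end ContourIntegral

/-! ### Cauchy's theorem and the residue theorem on convex open sets -/

section ClosedContour

variable {p : ℂ} {γ : Path p p} {U : Set ℂ}

theorem contourIntegral_eq_zero (hγ : IsPiecewiseC1 γ) (hU : Convex ℝ U) (hUo : IsOpen U)
    (hγU : range γ ⊆ U) {f : ℂ → ℂ} (hf : DifferentiableOn ℂ f U) : contourIntegral γ f = 0 := by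
  obtain ⟨g, hg⟩ := hU.exists_forall_hasDerivWithinAt hf
  obtain ⟨s, hs, hs_deriv⟩ := hγ.hasDerivAt_off_countable
  have hg_deriv : ∀ t, HasDerivAt g (f (γ.extend t)) (γ.extend t) := fun t =>
    have h_mem := hγU (extend_mem_range γ t)
    (hg _ h_mem).hasDerivAt (hUo.mem_nhds h_mem)
  have h_ftc := integral_eq_of_hasDerivAt_off_countable (g ∘ γ.extend)
    (curveIntegralFun (oneForm f) γ) hs (a := 0) (b := 1)
    (fun t _ =>
      ((hg_deriv t).continuousAt.comp γ.continuous_extend.continuousAt).continuousWithinAt)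
    (fun t ht => by
      rw [min_eq_left zero_le_one, max_eq_right zero_le_one] at ht
      rw [curveIntegralFun_oneForm, mul_comm]
      exact (hg_deriv t).comp_of_eq t (hs_deriv t ht) rfl)
    (hγ.curveIntegrable (hf.continuousOn.mono hγU))
  rw [contourIntegral, curveIntegral_def, h_ftc]
  simp

theorem EncirclesOnce.mem_of_convex (hγ : IsPiecewiseC1 γ) (hU : Convex ℝ U) (hUo : IsOpen U)
    (hγU : range γ ⊆ U) {z : ℂ} (hz : EncirclesOnce γ z) : z ∈ U := by
  by_contra h
  have h_diff : DifferentiableOn ℂ (fun t => (t - z)⁻¹) U := by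
    refine (differentiableOn_id.sub_const z).inv fun t ht => sub_ne_zero.2 ?_
    rintro rfl
    exact h ht
  have h_winding := hz.2
  rw [windingNumber, contourIntegral_eq_zero hγ hU hUo hγU h_diff, mul_zero] at h_winding
  exact zero_ne_one h_winding

theorem EncirclesOnce.contourIntegral_inv {z : ℂ} (hz : EncirclesOnce γ z) :
    contourIntegral γ (fun t => (t - z)⁻¹) = 2 * Real.pi * Complex.I := by
  have h_winding := hz.2
  rwa [windingNumber, inv_mul_eq_iff_eq_mul₀ Complex.two_pi_I_ne_zero, mul_one] at h_winding

theorem EncirclesOnce.ne {z t : ℂ} (hz : EncirclesOnce γ z) (ht : t ∈ range γ) : t ≠ z := by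
  rintro rfl
  exact hz.1 ht

theorem EncirclesOnce.continuousOn_inv_sub {z : ℂ} (hz : EncirclesOnce γ z) :
    ContinuousOn (fun t => (t - z)⁻¹) (range γ) :=
  (continuousOn_id.sub continuousOn_const).inv₀ fun _ ht => sub_ne_zero.2 (hz.ne ht)

theorem EncirclesOnce.contourIntegral_mul_inv (hγ : IsPiecewiseC1 γ) (hU : Convex ℝ U)
    (hUo : IsOpen U) (hγU : range γ ⊆ U) {z : ℂ} (hz : EncirclesOnce γ z) {F : ℂ → ℂ}
    (hF : DifferentiableOn ℂ F U) :
    contourIntegral γ (fun t => F t * (t - z)⁻¹) = 2 * Real.pi * Complex.I * F z := by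
  have hzU := hz.mem_of_convex hγ hU hUo hγU
  have h_slope : DifferentiableOn ℂ (dslope F z) U :=
    (Complex.differentiableOn_dslope (hUo.mem_nhds hzU)).2 hF
  have h_split : contourIntegral γ (fun t => F t * (t - z)⁻¹) =
      contourIntegral γ fun t => dslope F z t + F z * (t - z)⁻¹ := by
    refine contourIntegral_congr countable_empty fun t ht _ => ?_
    have h_ne := hz.ne ht
    rw [dslope_of_ne _ h_ne, slope_def_field]
    ring
  have h_int : CurveIntegrable (oneForm fun t => F z * (t - z)⁻¹) γ :=
    hγ.curveIntegrable (continuousOn_const.mul hz.continuousOn_inv_sub)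
  rw [h_split, contourIntegral_add (hγ.curveIntegrable (h_slope.continuousOn.mono hγU)) h_int,
    contourIntegral_eq_zero hγ hU hUo hγU h_slope, contourIntegral_const_mul,
    hz.contourIntegral_inv]
  ring

theorem inv_prod_sub_eq_sum {K ι : Type*} [Field K] [DecidableEq ι] {s : Finset ι} {v : ι → K}
    (hs : s.Nonempty) (hv : InjOn v s) {t : K} (ht : ∀ i ∈ s, t ≠ v i) :
    (∏ i ∈ s, (t - v i))⁻¹ = ∑ i ∈ s, Lagrange.nodalWeight s v i * (t - v i)⁻¹ := by
  have h := congr_arg (Polynomial.eval t) (Lagrange.sum_basis hv hs)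
  rw [Polynomial.eval_finsetSum, Polynomial.eval_one] at h
  refine inv_eq_of_mul_eq_one_right ?_
  rw [Finset.mul_sum, ← h]
  refine Finset.sum_congr rfl fun i hi => ?_
  rw [Lagrange.eval_basis_not_at_node hi (ht i hi), Lagrange.eval_nodal]

theorem contourIntegral_mul_inv_prod {ι : Type*} [DecidableEq ι] (hγ : IsPiecewiseC1 γ)
    (hU : Convex ℝ U) (hUo : IsOpen U) (hγU : range γ ⊆ U) {s : Finset ι} {v : ι → ℂ}
    (hs : s.Nonempty) (hv : InjOn v s) (hγv : ∀ i ∈ s, EncirclesOnce γ (v i)) {F : ℂ → ℂ}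
    (hF : DifferentiableOn ℂ F U) :
    contourIntegral γ (fun t => F t * (∏ i ∈ s, (t - v i))⁻¹) =
      2 * Real.pi * Complex.I * ∑ i ∈ s, F (v i) * Lagrange.nodalWeight s v i := by
  have h_split : contourIntegral γ (fun t => F t * (∏ i ∈ s, (t - v i))⁻¹) =
      contourIntegral γ fun t =>
        ∑ i ∈ s, Lagrange.nodalWeight s v i * (F t * (t - v i)⁻¹) := by
    refine contourIntegral_congr countable_empty fun t ht _ => ?_
    rw [inv_prod_sub_eq_sum hs hv fun i hi => (hγv i hi).ne ht, Finset.mul_sum]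
    exact Finset.sum_congr rfl fun i _ => mul_left_comm _ _ _
  have h_int : ∀ i ∈ s,
      CurveIntegrable (oneForm fun t => Lagrange.nodalWeight s v i * (F t * (t - v i)⁻¹)) γ :=
    fun i hi => hγ.curveIntegrable <|
      continuousOn_const.mul ((hF.continuousOn.mono hγU).mul (hγv i hi).continuousOn_inv_sub)
  rw [h_split, contourIntegral_finset_sum _ h_int, Finset.mul_sum]
  refine Finset.sum_congr rfl fun i hi => ?_
  rw [contourIntegral_const_mul, (hγv i hi).contourIntegral_mul_inv hγ hU hUo hγU hF]
  ring

theorem exists_convex_isOpen_of_re_mem (γ : Path p p) {S : Set ℝ} (hS : IsOpen S)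
    (hγS : ∀ u, (γ u).re ∈ S) :
    ∃ U : Set ℂ, Convex ℝ U ∧ IsOpen U ∧ range γ ⊆ U ∧ U ⊆ Complex.re ⁻¹' S := by
  refine ⟨Complex.re ⁻¹' connectedComponentIn S p.re, ?_,
    hS.connectedComponentIn.preimage Complex.continuous_re, ?_,
    preimage_mono (connectedComponentIn_subset S p.re)⟩
  · exact isPreconnected_connectedComponentIn.ordConnected.convex.linear_preimage Complex.reLm
  · have h_connected : IsPreconnected (range fun u => (γ u).re) :=
      isPreconnected_range (by fun_prop)
    rintro _ ⟨u, rfl⟩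
    exact h_connected.subset_connectedComponentIn ⟨0, congr_arg Complex.re γ.source⟩
      (range_subset_iff.2 hγS) ⟨u, rfl⟩

end ClosedContour

theorem nodalWeight_range_natCast {K : Type*} [Field K] {N n : ℕ} (hn : n < N) :
    Lagrange.nodalWeight (Finset.range N) (fun i : ℕ => (i : K)) n =
      ((-1) ^ (N - 1 - n) * (n ! * (N - 1 - n)! : K))⁻¹ := by
  obtain ⟨d, rfl⟩ : ∃ d, N = n + (1 + d) := ⟨N - 1 - n, by omega⟩
  have h_below : ∏ j ∈ Finset.range n, ((n : K) - j) = n ! := by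
    rw [← falling_eq_prod, falling_natCast, Nat.descFactorial_self]
  have h_above : ∏ j ∈ Finset.range d, ((n : K) - ((n + (1 + j) : ℕ) : K)) = (-1) ^ d * d ! := by
    rw [← falling_neg_one, falling_eq_prod]
    refine Finset.prod_congr rfl fun j _ => ?_
    push_cast
    ring
  have h_pred : n + (1 + d) - 1 - n = d := by omega
  rw [Lagrange.nodalWeight, Finset.prod_inv_distrib, ← Finset.filter_ne', Finset.prod_filter,
    Finset.prod_range_add, Finset.prod_range_add, Finset.prod_range_one, add_zero,
    if_neg (not_not.2 rfl), one_mul, h_pred, mul_left_comm, ← h_below, ← h_above]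
  congr 2 <;> refine Finset.prod_congr rfl fun j hj => if_pos ?_
  · exact (Finset.mem_range.1 hj).ne
  · omega

/-! ### The Gamma function on vertical lines -/

theorem norm_Gamma_le {s : ℂ} (hs : 0 < s.re) : ‖Complex.Gamma s‖ ≤ Real.Gamma s.re := by
  rw [Complex.Gamma_eq_integral hs, Real.Gamma_eq_integral hs, Complex.GammaIntegral]
  refine (norm_integral_le_integral_norm _).trans_eq ?_
  refine setIntegral_congr_fun measurableSet_Ioi fun x hx => ?_
  simp only [norm_mul]
  rw [Complex.norm_cpow_eq_rpow_re_of_pos hx, Complex.norm_real,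
    Real.norm_of_nonneg (by positivity), Complex.sub_re, Complex.one_re]

theorem ne_neg_natCast_of_re_pos {s : ℂ} (hs : 0 < s.re) (n : ℕ) : s ≠ -n := by
  rintro rfl
  rw [Complex.neg_re, Complex.natCast_re, neg_pos] at hs
  exact hs.not_ge n.cast_nonneg

theorem norm_pow_mul_Gamma_le (d : ℕ) {s : ℂ} (hs : 0 < s.re) :
    ‖s ^ d * Complex.Gamma s‖ ≤ Real.Gamma (s.re + d) := by
  induction d generalizing s with
  | zero => simpa using norm_Gamma_le hs
  | succ d ih =>
    have h_ne : s ≠ 0 := by simpa using ne_neg_natCast_of_re_pos hs 0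
    have h_norm : ‖s‖ ≤ ‖s + 1‖ := by
      rw [← sq_le_sq₀ (norm_nonneg _) (norm_nonneg _), Complex.sq_norm, Complex.sq_norm,
        Complex.normSq_apply, Complex.normSq_apply, Complex.add_re, Complex.add_im, Complex.one_re,
        Complex.one_im]
      nlinarith
    calc ‖s ^ (d + 1) * Complex.Gamma s‖ = ‖s‖ ^ d * ‖s * Complex.Gamma s‖ := by
          rw [pow_succ, mul_assoc, norm_mul, norm_pow]
      _ ≤ ‖s + 1‖ ^ d * ‖s * Complex.Gamma s‖ := by gcongr
      _ = ‖(s + 1) ^ d * Complex.Gamma (s + 1)‖ := by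
          rw [Complex.Gamma_add_one s h_ne, norm_mul ((s + 1) ^ d), norm_pow]
      _ ≤ Real.Gamma ((s + 1).re + d) := ih (by rw [Complex.add_re, Complex.one_re]; positivity)
      _ = Real.Gamma (s.re + (d + 1 : ℕ)) := by
          rw [Complex.add_re, Complex.one_re, Nat.cast_succ, add_assoc, add_comm (1 : ℝ)]

theorem exists_norm_eval_mul_Gamma_le (P : Polynomial ℂ) {c : ℝ} (hc : 0 < c) :
    ∃ B : ℝ, ∀ s : ℂ, s.re = c → ‖P.eval s * Complex.Gamma s‖ ≤ B := by
  refine ⟨∑ i ∈ Finset.range (P.natDegree + 1), ‖P.coeff i‖ * Real.Gamma (c + i),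
    fun s hs => ?_⟩
  rw [Polynomial.eval_eq_sum_range, Finset.sum_mul]
  refine (norm_sum_le _ _).trans (Finset.sum_le_sum fun i _ => ?_)
  rw [mul_assoc, norm_mul, ← hs]
  exact mul_le_mul_of_nonneg_left (norm_pow_mul_Gamma_le i (hs ▸ hc)) (norm_nonneg _)

theorem re_add_mul_I (c v : ℝ) : ((c : ℂ) + v * Complex.I).re = c := by simp

theorem continuous_Gamma_vertical {c : ℝ} (hc : 0 < c) :
    Continuous fun v : ℝ => Complex.Gamma (c + v * Complex.I) := by
  refine continuous_iff_continuousAt.2 fun v => ?_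
  have h : ContinuousAt Complex.Gamma (c + v * Complex.I) :=
    (Complex.differentiableAt_Gamma _ <|
      ne_neg_natCast_of_re_pos (by rwa [re_add_mul_I])).continuousAt
  exact h.comp (f := fun v : ℝ => (c : ℂ) + v * Complex.I) (by fun_prop)

theorem integrable_eval_mul_Gamma (P : Polynomial ℂ) {c : ℝ} (hc : 0 < c) :
    Integrable fun v : ℝ =>
      P.eval ((c : ℂ) + v * Complex.I) * Complex.Gamma (c + v * Complex.I) := by
  set Q : Polynomial ℂ := 1 - (Polynomial.X - Polynomial.C (c : ℂ)) ^ 2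
  have hQ : ∀ v : ℝ, Q.eval ((c : ℂ) + v * Complex.I) = ((1 + v ^ 2 : ℝ) : ℂ) := fun v => by
    simp [Q, mul_pow]
  obtain ⟨B, hB⟩ := exists_norm_eval_mul_Gamma_le (P * Q) hc
  refine (integrable_inv_one_add_sq.const_mul B).mono' (Continuous.aestronglyMeasurable <|
    (P.continuous.comp (by fun_prop)).mul (continuous_Gamma_vertical hc)) (ae_of_all _ fun v => ?_)
  have h_pos : 0 < 1 + v ^ 2 := by positivity
  have h_bound := hB _ (re_add_mul_I c v)
  rw [Polynomial.eval_mul, mul_right_comm, norm_mul, hQ, Complex.norm_real,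
    Real.norm_of_nonneg h_pos.le] at h_bound
  rwa [← div_eq_mul_inv, le_div_iff₀ h_pos]

/-- The Mellin–Barnes integrand of the function `2 r^{κ/2} K_κ(2√r)`. -/
def barnesWeight (κ : ℕ) (r : ℝ) (s : ℂ) : ℂ :=
  Complex.Gamma s * Complex.Gamma (s + κ) * (r : ℂ) ^ (-s)

theorem barnesWeight_eq_ascPochhammer_mul (l ν : ℕ) (r : ℝ) {s : ℂ} (hs : 0 < s.re) :
    barnesWeight (l + ν) r s = (ascPochhammer ℂ l).eval (s + ν) * barnesWeight ν r s := by
  have h_re : 0 < (s + ν).re := by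
    rw [Complex.add_re, Complex.natCast_re]
    positivity
  have h_ratio := Complex.Gamma_add_nat_div_Gamma_eq (n := l) (s + ν)
    (ne_neg_natCast_of_re_pos h_re)
  rw [div_eq_iff (Complex.Gamma_ne_zero_of_re_pos h_re)] at h_ratio
  rw [barnesWeight, barnesWeight, Nat.cast_add, add_comm (l : ℂ), ← add_assoc, h_ratio]
  ring

theorem integrable_eval_mul_barnesWeight (P : Polynomial ℂ) (κ : ℕ) {c r : ℝ} (hc : 0 < c)
    (hr : 0 < r) :
    Integrable fun v : ℝ =>
      P.eval ((c : ℂ) + v * Complex.I) * barnesWeight κ r (c + v * Complex.I) := by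
  have h_pos : 0 < c + κ := by positivity
  have h_shift : ∀ v : ℝ, (c : ℂ) + v * Complex.I + κ = ((c + κ : ℝ) : ℂ) + v * Complex.I := by
    intro v
    push_cast
    ring
  have h_cont : Continuous fun v : ℝ =>
      Complex.Gamma (c + v * Complex.I + κ) * (r : ℂ) ^ (-(c + v * Complex.I) : ℂ) := by
    simp only [h_shift]
    refine (continuous_Gamma_vertical h_pos).mul (Continuous.const_cpow (by fun_prop) (Or.inl ?_))
    exact_mod_cast hr.ne'
  have h_bound : ∀ v : ℝ, ‖Complex.Gamma (c + v * Complex.I + κ) *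
      (r : ℂ) ^ (-(c + v * Complex.I) : ℂ)‖ ≤ Real.Gamma (c + κ) * r ^ (-c) := by
    intro v
    have h_norm := norm_Gamma_le (s := ((c + κ : ℝ) : ℂ) + v * Complex.I) (by rwa [re_add_mul_I])
    rw [re_add_mul_I] at h_norm
    rw [norm_mul, h_shift, Complex.norm_cpow_eq_rpow_re_of_pos hr, Complex.neg_re, re_add_mul_I]
    gcongr
  refine ((integrable_eval_mul_Gamma P hc).mul_bdd h_cont.aestronglyMeasurable
    (ae_of_all _ h_bound)).congr (ae_of_all _ fun v => ?_)
  simp only [barnesWeight]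
  ring

/-! ### Mellin transforms of multiplicative convolutions -/

theorem integrable_inv_mul_comp_mul_inv {A B : ℝ → ℂ} (hA_meas : Measurable A)
    (hB_meas : Measurable B) (hA : IntegrableOn A (Ioi 0)) (hB : IntegrableOn B (Ioi 0)) :
    Integrable (fun z : ℝ × ℝ => (z.2 : ℂ)⁻¹ * (A z.2 * B (z.1 * z.2⁻¹)))
      ((volume.restrict (Ioi 0)).prod (volume.restrict (Ioi 0))) := by
  have h_meas : Measurable fun z : ℝ × ℝ => (z.2 : ℂ)⁻¹ * (A z.2 * B (z.1 * z.2⁻¹)) := by fun_prop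
  rw [integrable_prod_iff' h_meas.aestronglyMeasurable]
  constructor
  · filter_upwards [ae_restrict_mem measurableSet_Ioi] with t ht
    refine Integrable.const_mul (Integrable.const_mul ?_ _) _
    refine (integrableOn_Ioi_comp_mul_right_iff B 0 (inv_pos.2 ht)).2 ?_
    rwa [zero_mul]
  · refine (hA.norm.mul_const (∫ u in Ioi 0, ‖B u‖)).congr ?_
    filter_upwards [ae_restrict_mem measurableSet_Ioi] with t ht
    have ht_pos : 0 < t := ht
    simp only [norm_mul, norm_inv, Complex.norm_real, Real.norm_of_nonneg ht_pos.le]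
    rw [integral_const_mul, integral_const_mul,
      integral_comp_mul_right_Ioi (fun u => ‖B u‖) 0 (inv_pos.2 ht), zero_mul, inv_inv, smul_eq_mul]
    field_simp

/-- Fubini's theorem for `x^{s-1} f(t) g(x/t) / t = t⁻¹ A(t) B(x/t)`, where
`A(t) = t^{s-1} f(t)` and `B(u) = u^{s-1} g(u)`. -/
theorem hasMellin_mulConvolution {f g : ℝ → ℂ} {s F G : ℂ} (hf_meas : Measurable f)
    (hg_meas : Measurable g) (hf : HasMellin f s F) (hg : HasMellin g s G) :
    HasMellin (fun x => ∫ t in Ioi (0 : ℝ), f t * g (x / t) / t) s (F * G) := by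
  set A : ℝ → ℂ := fun t => (t : ℂ) ^ (s - 1) * f t
  set B : ℝ → ℂ := fun u => (u : ℂ) ^ (s - 1) * g u
  have h_int := integrable_inv_mul_comp_mul_inv (A := A) (B := B) (by fun_prop) (by fun_prop)
    hf.1 hg.1
  have h_inner : EqOn (fun x : ℝ => ∫ t in Ioi (0 : ℝ), (t : ℂ)⁻¹ * (A t * B (x * t⁻¹)))
      (fun x : ℝ => (x : ℂ) ^ (s - 1) • ∫ t in Ioi (0 : ℝ), f t * g (x / t) / t) (Ioi 0) := by
    intro x hx
    simp only [smul_eq_mul, ← integral_const_mul]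
    refine setIntegral_congr_fun measurableSet_Ioi fun t ht => ?_
    have h_cpow : (t : ℂ) ^ (s - 1) * ((x * t⁻¹ : ℝ) : ℂ) ^ (s - 1) = (x : ℂ) ^ (s - 1) := by
      rw [← Complex.mul_cpow_ofReal_nonneg (le_of_lt ht) (mul_pos hx (inv_pos.2 ht)).le,
        ← Complex.ofReal_mul, mul_left_comm, mul_inv_cancel₀ (ne_of_gt ht), mul_one]
    simp only [A, B, ← h_cpow, div_eq_mul_inv]
    ring
  refine ⟨IntegrableOn.congr_fun h_int.integral_prod_left h_inner measurableSet_Ioi, ?_⟩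
  rw [mellin, ← setIntegral_congr_fun measurableSet_Ioi h_inner, integral_integral_swap h_int,
    ← hf.2, ← hg.2, mellin, ← integral_mul_const]
  refine setIntegral_congr_fun measurableSet_Ioi fun t ht => ?_
  have ht_ne : (t : ℂ) ≠ 0 := by exact_mod_cast ne_of_gt ht
  simp only [smul_eq_mul]
  rw [integral_const_mul, integral_const_mul, integral_comp_mul_right_Ioi B 0 (inv_pos.2 ht),
    zero_mul, inv_inv, Complex.real_smul, mellin]
  simp only [smul_eq_mul, A, B]
  field_simp

/-! ### The modified Bessel functions of the second kind -/

/-- The function `2 x^{κ/2} K_κ(2√x)`, as the multiplicative convolution of `e^{-t}` and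
`u^κ e^{-u}`. -/
def scaledBesselK (κ : ℕ) (x : ℝ) : ℝ :=
  ∫ t in Ioi (0 : ℝ), Real.exp (-t) * ((x / t) ^ κ * Real.exp (-(x / t))) / t

theorem hasMellin_exp_neg {s : ℂ} (hs : 0 < s.re) :
    HasMellin (fun t : ℝ => (Real.exp (-t) : ℂ)) s (Complex.Gamma s) := by
  refine ⟨(Complex.GammaIntegral_convergent hs).congr_fun (fun t _ => mul_comm _ _)
    measurableSet_Ioi, ?_⟩
  rw [Complex.Gamma_eq_integral hs, Complex.GammaIntegral_eq_mellin]

theorem hasMellin_pow_mul_exp_neg (κ : ℕ) {s : ℂ} (hs : 0 < s.re) :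
    HasMellin (fun t : ℝ => (t : ℂ) ^ κ * (Real.exp (-t) : ℂ)) s (Complex.Gamma (s + κ)) := by
  have h_pos : 0 < (s + κ).re := by
    rw [Complex.add_re, Complex.natCast_re]
    positivity
  have h := hasMellin_exp_neg h_pos
  constructor
  · simpa using (MellinConvergent.cpow_smul (a := (κ : ℂ))).2 h.1
  · simpa using (mellin_cpow_smul _ s (κ : ℂ)).trans h.2

theorem hasMellin_scaledBesselK (κ : ℕ) {s : ℂ} (hs : 0 < s.re) :
    HasMellin (fun x => (scaledBesselK κ x : ℂ)) s (Complex.Gamma s * Complex.Gamma (s + κ)) := by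
  convert hasMellin_mulConvolution (by fun_prop) (by fun_prop) (hasMellin_exp_neg hs)
    (hasMellin_pow_mul_exp_neg κ hs) using 2 with x
  rw [scaledBesselK, ← integral_complex_ofReal]
  push_cast
  rfl

theorem scaledBesselK_nonneg (κ : ℕ) {x : ℝ} (hx : 0 ≤ x) : 0 ≤ scaledBesselK κ x := by
  refine setIntegral_nonneg measurableSet_Ioi fun t ht => ?_
  have ht_pos : 0 < t := ht
  positivity

theorem pow_mul_exp_neg_div_le (κ : ℕ) {x t : ℝ} (hx : 0 < x) (ht : 0 < t) :
    (x / t) ^ κ * Real.exp (-(x / t)) / t ≤ (κ + 1)! / x := by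
  have h := Real.pow_div_factorial_le_exp (x := x / t) (by positivity) (κ + 1)
  rw [div_le_iff₀ (by positivity)] at h
  rw [Real.exp_neg, le_div_iff₀ hx, ← div_eq_mul_inv, div_div, div_mul_eq_mul_div,
    div_le_iff₀ (by positivity)]
  calc (x / t) ^ κ * x = (x / t) ^ (κ + 1) * t := by
        rw [pow_succ, mul_assoc, div_mul_cancel₀ _ ht.ne']
    _ ≤ Real.exp (x / t) * (κ + 1)! * t := by gcongr
    _ = (κ + 1)! * (Real.exp (x / t) * t) := by ring

theorem continuousAt_scaledBesselK (κ : ℕ) {y : ℝ} (hy : 0 < y) :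
    ContinuousAt (scaledBesselK κ) y := by
  refine continuousAt_of_dominated (bound := fun t => Real.exp (-t) * ((κ + 1)! / (y / 2)))
    (Eventually.of_forall fun x => Measurable.aestronglyMeasurable (by fun_prop)) ?_
    ((integrableOn_exp_neg_Ioi 0).mul_const _) (Eventually.of_forall fun t => by fun_prop)
  filter_upwards [lt_mem_nhds (half_lt_self hy)] with x hx
  filter_upwards [ae_restrict_mem measurableSet_Ioi] with t ht
  have ht_pos : 0 < t := ht
  have hx_pos : 0 < x := (half_pos hy).trans hx
  rw [Real.norm_of_nonneg (by positivity), mul_div_assoc]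
  refine mul_le_mul_of_nonneg_left ?_ (Real.exp_pos _).le
  exact (pow_mul_exp_neg_div_le κ hx_pos ht).trans (by gcongr)

theorem verticalIntegral_barnesWeight (κ : ℕ) {c r : ℝ} (hc : 0 < c) (hr : 0 < r) :
    verticalIntegral c (barnesWeight κ r) = 2 * Real.pi * Complex.I * scaledBesselK κ r := by
  have h_mellin : ∀ v : ℝ, mellin (fun x => (scaledBesselK κ x : ℂ)) (c + v * Complex.I) =
      Complex.Gamma (c + v * Complex.I) * Complex.Gamma (c + v * Complex.I + κ) := fun v =>
    (hasMellin_scaledBesselK κ (by rwa [re_add_mul_I])).2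
  have h_vert : Complex.VerticalIntegrable (mellin fun x => (scaledBesselK κ x : ℂ)) c := by
    refine (integrable_eval_mul_barnesWeight 1 κ hc one_pos).congr (ae_of_all _ fun v => ?_)
    simp [h_mellin, barnesWeight]
  have h_inv := mellinInv_mellin_eq c (fun x => (scaledBesselK κ x : ℂ)) hr
    (hasMellin_scaledBesselK κ (by simpa using hc)).1 h_vert
    (Complex.continuous_ofReal.continuousAt.comp (continuousAt_scaledBesselK κ hr))
  have h_integrand : ∀ v : ℝ, (r : ℂ) ^ (-(c + v * Complex.I : ℂ)) •
      mellin (fun x => (scaledBesselK κ x : ℂ)) (c + v * Complex.I) =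
        barnesWeight κ r (c + v * Complex.I) := fun v => by
    rw [h_mellin, barnesWeight, smul_eq_mul, mul_comm]
  simp_rw [mellinInv, h_integrand] at h_inv
  rw [verticalIntegral, ← h_inv, Complex.real_smul]
  push_cast
  field_simp

theorem hasMellin_scaledBesselK_mul_left (κ : ℕ) {a : ℝ} (ha : 0 < a) {s : ℂ} (hs : 0 < s.re) :
    HasMellin (fun x => (scaledBesselK κ (a * x) : ℂ)) s
      ((a : ℂ) ^ (-s) * (Complex.Gamma s * Complex.Gamma (s + κ))) := by
  have h := hasMellin_scaledBesselK κ hs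
  exact ⟨(MellinConvergent.comp_mul_left ha).2 h.1,
    (mellin_comp_mul_left _ s ha).trans (by rw [h.2, smul_eq_mul])⟩

theorem cpow_natCast_succ_sub_one_smul_ofReal (n : ℕ) (x b : ℝ) :
    (x : ℂ) ^ (((n + 1 : ℕ) : ℂ) - 1) • (b : ℂ) = ((x ^ n * b : ℝ) : ℂ) := by
  rw [Nat.cast_succ, add_sub_cancel_right, Complex.cpow_natCast, smul_eq_mul]
  push_cast
  rfl

theorem integrableOn_pow_mul_scaledBesselK (n κ : ℕ) {a : ℝ} (ha : 0 < a) :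
    IntegrableOn (fun x => x ^ n * scaledBesselK κ (a * x)) (Ioi 0) := by
  have h := (hasMellin_scaledBesselK_mul_left κ ha (s := (n + 1 : ℕ))
    (by rw [Complex.natCast_re]; positivity)).1
  simp only [MellinConvergent, cpow_natCast_succ_sub_one_smul_ofReal] at h
  exact h.re

theorem integral_pow_mul_scaledBesselK (n κ : ℕ) {a : ℝ} (ha : 0 < a) :
    ∫ x in Ioi (0 : ℝ), x ^ n * scaledBesselK κ (a * x) = (n ! * (n + κ)! : ℝ) / a ^ (n + 1) := by
  have h := (hasMellin_scaledBesselK_mul_left κ ha (s := (n + 1 : ℕ))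
    (by rw [Complex.natCast_re]; positivity)).2
  simp only [mellin, cpow_natCast_succ_sub_one_smul_ofReal, integral_complex_ofReal] at h
  rw [Complex.cpow_neg, Complex.cpow_natCast, Nat.cast_succ, Complex.Gamma_nat_eq_factorial,
    add_right_comm, ← Nat.cast_add, Complex.Gamma_nat_eq_factorial] at h
  rw [div_eq_inv_mul]
  exact_mod_cast h

/-! ### The biorthogonal functions and their Gram matrix -/

theorem alpha_pos {μ : ℝ} (hμ : 0 < μ) : 0 < alpha μ :=
  div_pos (by positivity) (by positivity)

theorem delta_ne_zero {μ : ℝ} (hμ : 0 < μ) (hμ_one : μ ≠ 1) : delta μ ≠ 0 :=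
  div_ne_zero (sub_ne_zero.2 hμ_one.symm) (by positivity)

theorem abs_delta_lt_alpha {μ : ℝ} (hμ : 0 < μ) : |delta μ| < alpha μ := by
  rw [delta, alpha, abs_div, abs_of_pos (show 0 < 2 * μ by positivity)]
  gcongr
  exact abs_lt.2 ⟨by linarith, by linarith⟩

theorem delta_sq_div_alpha_sq_lt_one {μ : ℝ} (hμ : 0 < μ) : delta μ ^ 2 / alpha μ ^ 2 < 1 := by
  rw [div_lt_one (pow_pos (alpha_pos hμ) 2), sq_lt_sq, abs_of_pos (alpha_pos hμ)]
  exact abs_delta_lt_alpha hμ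

theorem alpha_sq_sub_delta_sq_pos {μ : ℝ} (hμ : 0 < μ) : 0 < alpha μ ^ 2 - delta μ ^ 2 := by
  rw [sub_pos, ← div_lt_one (pow_pos (alpha_pos hμ) 2)]
  exact delta_sq_div_alpha_sq_lt_one hμ

theorem rpow_half_mul_sqrt_pow (κ n : ℕ) {x : ℝ} (hx : 0 < x) :
    x ^ ((κ : ℝ) / 2) * √x ^ (2 * n + κ) = x ^ (n + κ) := by
  rw [Real.sqrt_eq_rpow, ← Real.rpow_natCast, ← Real.rpow_mul hx.le, ← Real.rpow_add hx,
    ← Real.rpow_natCast]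
  push_cast
  ring_nf

theorem scaledBesselK_alpha_sq_mul (ν : ℕ) (μ : ℝ) (l : ℕ) {x : ℝ} (hx : 0 < x) :
    scaledBesselK (l + ν) (alpha μ ^ 2 * x) = 2 * alpha μ ^ (l + ν) * phi ν μ l x := by
  have h_pow := rpow_half_mul_sqrt_pow (l + ν) 0 hx
  have h_exp : ∀ t : ℝ, Real.exp (-t - (2 * alpha μ * √x) ^ 2 / (4 * t)) =
      Real.exp (-t) * Real.exp (-(alpha μ ^ 2 * x / t)) := fun t => by
    rw [← Real.exp_add, mul_pow, Real.sq_sqrt hx.le]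
    ring_nf
  rw [mul_zero, zero_add, Nat.cast_add] at h_pow
  rw [scaledBesselK, phi, besselK, ← integral_const_mul, ← integral_const_mul, ← integral_const_mul]
  refine integral_congr_ae (ae_of_all _ fun t => ?_)
  simp only [h_exp]
  rw [div_pow, mul_pow, ← h_pow]
  ring

theorem psi_eq_tsum (μ : ℝ) (j : ℕ) {x : ℝ} (hx : 0 < x) :
    psi μ j x = ∑' i : ℕ, delta μ ^ (2 * i + j) / (i ! * (i + j)!) * x ^ (i + j) := by
  rw [psi, besselI, ← tsum_mul_left]
  refine tsum_congr fun i => ?_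
  rw [show 2 * delta μ * √x / 2 = delta μ * √x by ring, mul_pow, ← rpow_half_mul_sqrt_pow j i hx,
    add_comm (j : ℝ), ← Nat.cast_add, Real.Gamma_nat_eq_factorial]
  ring

/-- The `i`-th term of the power series of `ψ_j(x)`, times `scaledBesselK κ (α² x)`. -/
def gramTerm (μ : ℝ) (j κ i : ℕ) (x : ℝ) : ℝ :=
  delta μ ^ (2 * i + j) / (i ! * (i + j)!) * (x ^ (i + j) * scaledBesselK κ (alpha μ ^ 2 * x))

theorem integrableOn_gramTerm {μ : ℝ} (hμ : 0 < μ) (j κ i : ℕ) :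
    IntegrableOn (gramTerm μ j κ i) (Ioi 0) :=
  (integrableOn_pow_mul_scaledBesselK _ κ (pow_pos (alpha_pos hμ) 2)).const_mul _

theorem integral_gramTerm {μ : ℝ} (hμ : 0 < μ) (j κ i : ℕ) :
    ∫ x in Ioi (0 : ℝ), gramTerm μ j κ i x = delta μ ^ j / alpha μ ^ (2 * (j + 1)) *
      (((i + (j + κ))! / i ! : ℝ) * (delta μ ^ 2 / alpha μ ^ 2) ^ i) := by
  have hα := (alpha_pos hμ).ne'
  have h_factorial : ((i + j)! : ℝ) ≠ 0 := Nat.cast_ne_zero.2 (i + j).factorial_ne_zero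
  simp only [gramTerm]
  rw [integral_const_mul, integral_pow_mul_scaledBesselK _ κ (pow_pos (alpha_pos hμ) 2),
    add_assoc, div_pow]
  field_simp
  ring

theorem integral_norm_gramTerm (μ : ℝ) (j κ i : ℕ) :
    ∫ x in Ioi (0 : ℝ), ‖gramTerm μ j κ i x‖ = ‖∫ x in Ioi (0 : ℝ), gramTerm μ j κ i x‖ := by
  have h_nonneg : ∀ x ∈ Ioi (0 : ℝ), 0 ≤ x ^ (i + j) * scaledBesselK κ (alpha μ ^ 2 * x) :=
    fun x (hx : 0 < x) => mul_nonneg (by positivity) (scaledBesselK_nonneg κ (by positivity))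
  simp only [gramTerm, norm_mul _ (_ * _), integral_const_mul]
  rw [norm_mul, Real.norm_of_nonneg (setIntegral_nonneg measurableSet_Ioi h_nonneg)]
  congr 1
  exact setIntegral_congr_fun measurableSet_Ioi fun x hx =>
    Real.norm_of_nonneg (h_nonneg x hx)

theorem norm_delta_sq_div_alpha_sq_lt_one {μ : ℝ} (hμ : 0 < μ) :
    ‖delta μ ^ 2 / alpha μ ^ 2‖ < 1 := by
  rw [Real.norm_of_nonneg (by positivity)]
  exact delta_sq_div_alpha_sq_lt_one hμ

theorem hasSum_integral_psi_mul_scaledBesselK {μ : ℝ} (hμ : 0 < μ) (j κ : ℕ) :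
    HasSum (fun i : ℕ => delta μ ^ j / alpha μ ^ (2 * (j + 1)) *
        (((i + (j + κ))! / i ! : ℝ) * (delta μ ^ 2 / alpha μ ^ 2) ^ i))
      (∫ x in Ioi (0 : ℝ), psi μ j x * scaledBesselK κ (alpha μ ^ 2 * x)) := by
  have h_summable : Summable fun i => ∫ x in Ioi (0 : ℝ), ‖gramTerm μ j κ i x‖ := by
    simp_rw [integral_norm_gramTerm, integral_gramTerm hμ]
    exact ((hasSum_factorial_div_factorial_mul_geometric (j + κ)
      (norm_delta_sq_div_alpha_sq_lt_one hμ)).summable.mul_left _).norm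
  have h := hasSum_integral_of_summable_integral_norm (integrableOn_gramTerm hμ j κ) h_summable
  simp_rw [integral_gramTerm hμ] at h
  have h_series : EqOn (fun x => ∑' i, gramTerm μ j κ i x)
      (fun x => psi μ j x * scaledBesselK κ (alpha μ ^ 2 * x)) (Ioi 0) := fun x hx => by
    simp only [gramTerm]
    rw [psi_eq_tsum μ j hx, ← tsum_mul_right]
    exact tsum_congr fun i => by ring
  rwa [setIntegral_congr_fun measurableSet_Ioi h_series] at h

/-! ### Biorthogonality -/

theorem sum_mul_integral_psi_mul_scaledBesselK {μ : ℝ} (hμ : 0 < μ) (hμ_one : μ ≠ 1) (ν : ℕ)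
    {N n j : ℕ} (hn : n < N) (hj : j < N) {d : ℕ → ℂ}
    (hd : ∀ s, (mellinPoly N ν n ((delta μ / alpha μ : ℝ) ^ 2 : ℂ)).eval s =
      ∑ l ∈ Finset.range N, d l * (ascPochhammer ℂ l).eval (s + ν)) :
    ∑ l ∈ Finset.range N, d l *
        (∫ x in Ioi (0 : ℝ), psi μ j x * scaledBesselK (l + ν) (alpha μ ^ 2 * x) : ℝ) =
      ((delta μ : ℂ) ^ j * (alpha μ : ℂ) ^ 2)⁻¹ *
        if j = n then (-1) ^ (N - 1 - n) * (n ! * (N - 1 - n)! : ℂ) *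
          (((delta μ / alpha μ : ℝ) ^ 2 : ℂ) ^ n *
            ((n + ν)! / (1 - (delta μ / alpha μ : ℝ) ^ 2 : ℂ) ^ (n + ν + 1))) else 0 := by
  have hα : (alpha μ : ℂ) ≠ 0 := Complex.ofReal_ne_zero.2 (alpha_pos hμ).ne'
  have hδ : (delta μ : ℂ) ≠ 0 := Complex.ofReal_ne_zero.2 (delta_ne_zero hμ hμ_one)
  have hq : ‖((delta μ / alpha μ : ℝ) ^ 2 : ℂ)‖ < 1 := by
    rw [← Complex.ofReal_pow, Complex.norm_real, div_pow]
    exact norm_delta_sq_div_alpha_sq_lt_one hμ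
  have h_gram := hasSum_sum fun l (_ : l ∈ Finset.range N) =>
    (Complex.hasSum_ofReal.2 (hasSum_integral_psi_mul_scaledBesselK hμ j (l + ν))).mul_left (d l)
  refine h_gram.unique (((hasSum_mellinPoly ν hn hj hq).mul_left _).congr_fun fun i => ?_)
  rw [hd, Finset.mul_sum, Finset.mul_sum, Finset.mul_sum]
  refine Finset.sum_congr rfl fun l _ => ?_
  have h_factorial : ((i + j + ν)! : ℂ) ≠ 0 := Nat.cast_ne_zero.2 (i + j + ν).factorial_ne_zero
  have h_shift : ((i + j : ℕ) : ℂ) + 1 + ν = ((i + j + ν : ℕ) : ℂ) + 1 := by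
    push_cast
    ring
  rw [h_shift, eval_ascPochhammer_natCast_add_one, show i + (j + (l + ν)) = i + j + ν + l by ring]
  push_cast
  rw [div_pow, div_pow, div_pow]
  field_simp
  ring

/-- The residue at `t = n` of the factors of the integrand that depend on `t` only is
`residueConst N ν μ n * ψ_n(x)`. -/
def residueConst (N ν : ℕ) (μ : ℝ) (n : ℕ) : ℂ :=
  (1 - (delta μ : ℂ) ^ 2 / (alpha μ : ℂ) ^ 2) ^ ν *
    ((alpha μ : ℂ) ^ 2 - (delta μ : ℂ) ^ 2) ^ (n + 1) *
    ((delta μ : ℂ) ^ n * ((-1) ^ (N - 1 - n) * (n ! * (N - 1 - n)! : ℂ)) * (n + ν)!)⁻¹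

theorem residueConst_mul_sum_integral_psi_mul_scaledBesselK {μ : ℝ} (hμ : 0 < μ) (hμ_one : μ ≠ 1)
    (ν : ℕ) {N n j : ℕ} (hn : n < N) (hj : j < N) {d : ℕ → ℂ}
    (hd : ∀ s, (mellinPoly N ν n ((delta μ / alpha μ : ℝ) ^ 2 : ℂ)).eval s =
      ∑ l ∈ Finset.range N, d l * (ascPochhammer ℂ l).eval (s + ν)) :
    residueConst N ν μ n * ∑ l ∈ Finset.range N, d l *
        (∫ x in Ioi (0 : ℝ), psi μ j x * scaledBesselK (l + ν) (alpha μ ^ 2 * x) : ℝ) =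
      if n = j then 1 else 0 := by
  rw [sum_mul_integral_psi_mul_scaledBesselK hμ hμ_one ν hn hj hd]
  obtain rfl | h_ne := eq_or_ne n j
  · have hα : (alpha μ : ℂ) ≠ 0 := Complex.ofReal_ne_zero.2 (alpha_pos hμ).ne'
    have hδ : (delta μ : ℂ) ≠ 0 := Complex.ofReal_ne_zero.2 (delta_ne_zero hμ hμ_one)
    have hαδ : (alpha μ : ℂ) ^ 2 - (delta μ : ℂ) ^ 2 ≠ 0 := by
      exact_mod_cast (alpha_sq_sub_delta_sq_pos hμ).ne'
    have h_factorial : ∀ m : ℕ, (m ! : ℂ) ≠ 0 := fun m => Nat.cast_ne_zero.2 m.factorial_ne_zero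
    have h_factorial_n := h_factorial n
    have h_factorial_N := h_factorial (N - 1 - n)
    have h_factorial_ν := h_factorial (n + ν)
    rw [if_pos rfl, if_pos rfl, residueConst]
    push_cast
    rw [div_pow, one_sub_div (pow_ne_zero 2 hα), div_pow, div_pow, div_pow]
    field_simp
    ring
  · rw [if_neg h_ne, if_neg h_ne.symm, mul_zero, mul_zero]

theorem nonsing_inv_map_of_mul_map_eq_one {ι K L : Type*} [Fintype ι] [DecidableEq ι] [Field K]
    [Field L] (f : K →+* L) {G : Matrix ι ι K} {D : Matrix ι ι L} (h : D * G.map f = 1) :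
    G⁻¹.map f = D := by
  have h_det : IsUnit G.det := by
    rw [isUnit_iff_ne_zero]
    intro h_zero
    have h_one := congr_arg Matrix.det h
    rw [Matrix.det_mul, ← RingHom.mapMatrix_apply, ← RingHom.map_det, h_zero, map_zero, mul_zero,
      Matrix.det_one] at h_one
    exact zero_ne_one h_one
  refine (left_inv_eq_right_inv h ?_).symm
  rw [← Matrix.map_mul, Matrix.mul_nonsing_inv _ h_det, Matrix.map_one _ f.map_zero f.map_one]

theorem correlationKernel_eq_of_mul_gramMatrix_eq_one {N ν : ℕ} {μ : ℝ}
    {D : Matrix (Fin N) (Fin N) ℂ} (hD : D * (gramMatrix N ν μ).map Complex.ofRealHom = 1)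
    (x y : ℝ) :
    (correlationKernel N ν μ x y : ℂ) =
      ∑ n : Fin N, psi μ n x * ∑ l : Fin N, D n l * phi ν μ l y := by
  simp only [correlationKernel, ← nonsing_inv_map_of_mul_map_eq_one Complex.ofRealHom hD,
    Matrix.map_apply, Complex.ofRealHom_eq_coe, Complex.ofReal_sum, Complex.ofReal_mul,
    Finset.mul_sum]
  exact Finset.sum_congr rfl fun n _ => Finset.sum_congr rfl fun l _ => by ring

theorem integral_psi_mul_scaledBesselK (ν : ℕ) (μ : ℝ) (j l : ℕ) :
    ∫ x in Ioi (0 : ℝ), psi μ j x * scaledBesselK (l + ν) (alpha μ ^ 2 * x) =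
      2 * alpha μ ^ (l + ν) * ∫ x in Ioi (0 : ℝ), psi μ j x * phi ν μ l x := by
  rw [← integral_const_mul]
  refine setIntegral_congr_fun measurableSet_Ioi fun x hx => ?_
  simp only [scaledBesselK_alpha_sq_mul ν μ l hx]
  ring

theorem correlationKernel_eq_sum {μ : ℝ} (hμ : 0 < μ) (hμ_one : μ ≠ 1) (N ν : ℕ) {d : ℕ → ℕ → ℂ}
    (hd : ∀ n < N, ∀ s, (mellinPoly N ν n ((delta μ / alpha μ : ℝ) ^ 2 : ℂ)).eval s =
      ∑ l ∈ Finset.range N, d n l * (ascPochhammer ℂ l).eval (s + ν)) (x : ℝ) {y : ℝ}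
    (hy : 0 < y) :
    (correlationKernel N ν μ x y : ℂ) = ∑ n ∈ Finset.range N, residueConst N ν μ n * psi μ n x *
      ∑ l ∈ Finset.range N, d n l * scaledBesselK (l + ν) (alpha μ ^ 2 * y) := by
  let D : Matrix (Fin N) (Fin N) ℂ := Matrix.of fun n l =>
    residueConst N ν μ n * d n l * (2 * alpha μ ^ ((l : ℕ) + ν) : ℝ)
  have hD : D * (gramMatrix N ν μ).map Complex.ofRealHom = 1 := by
    ext n j
    have h := residueConst_mul_sum_integral_psi_mul_scaledBesselK hμ hμ_one ν n.2 j.2 (hd n n.2)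
    rw [Finset.sum_range, Finset.mul_sum] at h
    simp only [Matrix.mul_apply, Matrix.one_apply, Fin.ext_iff]
    rw [← h]
    refine Finset.sum_congr rfl fun l _ => ?_
    simp only [D, gramMatrix, Matrix.of_apply, Matrix.map_apply, Complex.ofRealHom_eq_coe,
      integral_psi_mul_scaledBesselK, Complex.ofReal_mul]
    ring
  rw [correlationKernel_eq_of_mul_gramMatrix_eq_one hD, Finset.sum_range]
  refine Finset.sum_congr rfl fun n _ => ?_
  rw [Finset.sum_range, Finset.mul_sum, Finset.mul_sum]
  refine Finset.sum_congr rfl fun l _ => ?_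
  simp only [D, Matrix.of_apply, scaledBesselK_alpha_sq_mul ν μ l hy, Complex.ofReal_mul]
  ring

/-! ### The dual functions -/

theorem verticalIntegral_congr_ae {c : ℝ} {f g : ℂ → ℂ}
    (h : ∀ᵐ v : ℝ, f (c + v * Complex.I) = g (c + v * Complex.I)) :
    verticalIntegral c f = verticalIntegral c g :=
  congr_arg (Complex.I * ·) (integral_congr_ae h)

theorem verticalIntegral_congr {c : ℝ} {f g : ℂ → ℂ} (h : ∀ s : ℂ, s.re = c → f s = g s) :
    verticalIntegral c f = verticalIntegral c g :=
  verticalIntegral_congr_ae (ae_of_all _ fun v => h _ (re_add_mul_I c v))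

theorem verticalIntegral_const_mul (c : ℝ) (a : ℂ) (f : ℂ → ℂ) :
    verticalIntegral c (fun s => a * f s) = a * verticalIntegral c f := by
  simp only [verticalIntegral, integral_const_mul]
  ring

theorem verticalIntegral_finset_sum {ι : Type*} (S : Finset ι) {c : ℝ} {f : ι → ℂ → ℂ}
    (hf : ∀ i ∈ S, Integrable fun v : ℝ => f i (c + v * Complex.I)) :
    verticalIntegral c (fun s => ∑ i ∈ S, f i s) = ∑ i ∈ S, verticalIntegral c (f i) := by
  simp only [verticalIntegral, integral_finsetSum S hf, Finset.mul_sum]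

theorem integrable_barnesWeight (κ : ℕ) {c r : ℝ} (hc : 0 < c) (hr : 0 < r) :
    Integrable fun v : ℝ => barnesWeight κ r (c + v * Complex.I) := by
  simpa only [Polynomial.eval_one, one_mul] using integrable_eval_mul_barnesWeight 1 κ hc hr

theorem verticalIntegral_eval_mul_barnesWeight {N ν : ℕ} {P : Polynomial ℂ} {d : ℕ → ℂ}
    (hP : ∀ s, P.eval s = ∑ l ∈ Finset.range N, d l * (ascPochhammer ℂ l).eval (s + ν)) {c r : ℝ}
    (hc : 0 < c) (hr : 0 < r) :
    verticalIntegral c (fun s => P.eval s * barnesWeight ν r s) =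
      2 * Real.pi * Complex.I * ∑ l ∈ Finset.range N, d l * scaledBesselK (l + ν) r := by
  have h_expand : ∀ s : ℂ, s.re = c → P.eval s * barnesWeight ν r s =
      ∑ l ∈ Finset.range N, d l * barnesWeight (l + ν) r s := fun s hs => by
    rw [hP, Finset.sum_mul]
    exact Finset.sum_congr rfl fun l _ => by
      rw [barnesWeight_eq_ascPochhammer_mul l ν _ (hs ▸ hc), mul_assoc]
  rw [verticalIntegral_congr h_expand, verticalIntegral_finset_sum _ fun l _ =>
    (integrable_barnesWeight (l + ν) hc hr).const_mul (d l), Finset.mul_sum]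
  refine Finset.sum_congr rfl fun l _ => ?_
  rw [verticalIntegral_const_mul, verticalIntegral_barnesWeight _ hc hr, mul_left_comm]

theorem verticalIntegral_mellinPoly_mul_barnesWeight (N ν n : ℕ) (q : ℂ) {c r : ℝ} (hc : 0 < c)
    (hr : 0 < r) :
    verticalIntegral c (fun s => (mellinPoly N ν n q).eval s * barnesWeight ν r s) =
      ∑ k ∈ Finset.range N, q ^ k * verticalIntegral c fun s =>
        (residuePoly ℂ N n k).eval (s - 1) * barnesWeight (k + ν) r s := by
  have h_expand : ∀ s : ℂ, s.re = c → (mellinPoly N ν n q).eval s * barnesWeight ν r s =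
      ∑ k ∈ Finset.range N, q ^ k *
        ((residuePoly ℂ N n k).eval (s - 1) * barnesWeight (k + ν) r s) := fun s hs => by
    rw [eval_mellinPoly, Finset.sum_mul]
    exact Finset.sum_congr rfl fun k _ => by
      rw [barnesWeight_eq_ascPochhammer_mul k ν _ (hs ▸ hc)]
      ring
  have h_integrable : ∀ k ∈ Finset.range N, Integrable fun v : ℝ =>
      q ^ k * ((residuePoly ℂ N n k).eval ((c : ℂ) + v * Complex.I - 1) *
        barnesWeight (k + ν) r (c + v * Complex.I)) := fun k _ => by
    have h := integrable_eval_mul_barnesWeight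
      ((residuePoly ℂ N n k).comp (Polynomial.X - 1)) (k + ν) hc hr
    simp only [Polynomial.eval_comp, Polynomial.eval_sub, Polynomial.eval_X,
      Polynomial.eval_one] at h
    exact h.const_mul (q ^ k)
  rw [verticalIntegral_congr h_expand, verticalIntegral_finset_sum _ h_integrable]
  simp only [verticalIntegral_const_mul]

/-- The Mellin–Barnes form of the combination of `φ_0, …, φ_{N-1}` that is biorthogonal to
`ψ_0, …, ψ_{N-1}`: its integral against `ψ_j` is `1` if `j = n` and `0` otherwise. The real number
`c > 0` fixes the line of integration, on which the value does not depend. -/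
def dualFun (N ν : ℕ) (μ : ℝ) (n : ℕ) (c y : ℝ) : ℂ :=
  residueConst N ν μ n * ((2 * Real.pi * Complex.I)⁻¹ * verticalIntegral c fun s =>
    (mellinPoly N ν n ((delta μ / alpha μ : ℝ) ^ 2 : ℂ)).eval s *
      barnesWeight ν (alpha μ ^ 2 * y) s)

theorem correlationKernel_eq_sum_psi_mul_dualFun {μ c y : ℝ} (hμ : 0 < μ) (hμ_one : μ ≠ 1)
    (N ν : ℕ) (hc : 0 < c) (x : ℝ) (hy : 0 < y) :
    (correlationKernel N ν μ x y : ℂ) =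
      ∑ n ∈ Finset.range N, psi μ n x * dualFun N ν μ n c y := by
  have hr : 0 < alpha μ ^ 2 * y := mul_pos (pow_pos (alpha_pos hμ) 2) hy
  choose! d hd using fun (n : ℕ) (hn : n < N) =>
    exists_eval_mellinPoly_eq_sum ν ((delta μ / alpha μ : ℝ) ^ 2 : ℂ) hn
  rw [correlationKernel_eq_sum hμ hμ_one N ν hd x hy]
  refine Finset.sum_congr rfl fun n hn => ?_
  rw [dualFun, verticalIntegral_eval_mul_barnesWeight (hd n (Finset.mem_range.1 hn)) hc hr,
    inv_mul_cancel_left₀ Complex.two_pi_I_ne_zero]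
  ring

/-! ### The regularized hypergeometric function -/

/-- The function `b ↦ ₀F₁(-; b | z) / Γ(b)`, which unlike `₀F₁(-; b | z)` itself is entire. -/
def regHyp0F1 (z b : ℂ) : ℂ := ∑' n : ℕ, z ^ n / n ! * (Complex.Gamma (b + n))⁻¹

theorem norm_inv_Gamma_add_one_le {s : ℂ} (hs : 1 ≤ ‖s‖) :
    ‖(Complex.Gamma (s + 1))⁻¹‖ ≤ ‖(Complex.Gamma s)⁻¹‖ := by
  rw [Complex.one_div_Gamma_eq_self_mul_one_div_Gamma_add_one s, norm_mul]
  exact le_mul_of_one_le_left (norm_nonneg _) hs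

theorem one_le_norm_add_natCast {b : ℂ} {n : ℕ} (h : ‖b‖ + 1 ≤ n) : 1 ≤ ‖b + n‖ := by
  have h_triangle := norm_sub_le (b + n) b
  rw [add_sub_cancel_left, Complex.norm_natCast] at h_triangle
  linarith

theorem exists_norm_inv_Gamma_add_natCast_le {S : Set ℂ} (hS : IsCompact S) :
    ∃ M : ℝ, ∀ b ∈ S, ∀ n : ℕ, ‖(Complex.Gamma (b + n))⁻¹‖ ≤ M := by
  obtain ⟨R, hR⟩ := hS.isBounded.exists_norm_le
  obtain ⟨n₀, hn₀⟩ := exists_nat_ge (R + 1)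
  choose B hB using fun n : ℕ => hS.exists_bound_of_continuousOn
    (Complex.differentiable_one_div_Gamma.continuous.comp
      (continuous_add_const (n : ℂ))).continuousOn
  obtain ⟨M, hM⟩ := ((Set.finite_Iic n₀).image B).bddAbove
  have h_initial : ∀ b ∈ S, ∀ n ≤ n₀, ‖(Complex.Gamma (b + n))⁻¹‖ ≤ M := fun b hb n hn =>
    (hB n b hb).trans (hM (mem_image_of_mem B hn))
  refine ⟨M, fun b hb n => ?_⟩
  obtain hn | hn := le_total n n₀
  · exact h_initial b hb n hn
  · induction n, hn using Nat.le_induction with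
    | base => exact h_initial b hb n₀ le_rfl
    | succ n hn ih =>
      have h_cast : (n₀ : ℝ) ≤ n := Nat.cast_le.2 hn
      have h_norm : 1 ≤ ‖b + n‖ := one_le_norm_add_natCast (by linarith [hR b hb])
      rw [Nat.cast_succ, ← add_assoc]
      exact (norm_inv_Gamma_add_one_le h_norm).trans ih

theorem differentiable_regHyp0F1 (z : ℂ) : Differentiable ℂ (regHyp0F1 z) := by
  intro b₀
  obtain ⟨M, hM⟩ := exists_norm_inv_Gamma_add_natCast_le (isCompact_closedBall b₀ 1)
  refine (Complex.differentiableOn_tsum_of_summable_norm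
    (u := fun n : ℕ => ‖z‖ ^ n / n ! * M) ((Real.summable_pow_div_factorial ‖z‖).mul_right M)
    (fun n => Differentiable.differentiableOn ?_) Metric.isOpen_ball
    fun n b hb => ?_).differentiableAt (Metric.ball_mem_nhds b₀ one_pos)
  · exact (Complex.differentiable_one_div_Gamma.comp (differentiable_id.add_const _)).const_mul _
  · rw [norm_mul, norm_div, norm_pow, Complex.norm_natCast]
    exact mul_le_mul_of_nonneg_left (hM b (Metric.ball_subset_closedBall hb) n) (by positivity)

theorem hyp0F1_mul_inv_Gamma {b : ℂ} (hb : ∀ k : ℕ, b ≠ -k) (z : ℂ) :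
    hyp0F1 b z * (Complex.Gamma b)⁻¹ = regHyp0F1 z b := by
  rw [hyp0F1, regHyp0F1, ← tsum_mul_right]
  refine tsum_congr fun n => ?_
  have h_Gamma := Complex.Gamma_ne_zero hb
  rw [← Complex.Gamma_add_nat_div_Gamma_eq b hb]
  field_simp

theorem pow_mul_regHyp0F1 {μ x : ℝ} (hδ : delta μ ≠ 0) (n : ℕ) (hx : 0 < x) :
    (x : ℂ) ^ n * regHyp0F1 ((delta μ ^ 2 * x : ℝ) : ℂ) (n + 1) =
      ((delta μ : ℂ) ^ n)⁻¹ * psi μ n x := by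
  have hδ' : (delta μ : ℂ) ≠ 0 := Complex.ofReal_ne_zero.2 hδ
  rw [psi_eq_tsum μ n hx, regHyp0F1, Complex.ofReal_tsum, ← tsum_mul_left, ← tsum_mul_left]
  refine tsum_congr fun m => ?_
  have h_shift : (n : ℂ) + 1 + m = ((m + n : ℕ) : ℂ) + 1 := by
    push_cast
    ring
  rw [h_shift, Complex.Gamma_nat_eq_factorial]
  push_cast
  rw [mul_pow, ← pow_mul, pow_add, pow_add]
  field_simp

/-! ### The integrand -/

theorem inv_Gamma_sub_natCast (s : ℂ) (r : ℕ) :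
    (Complex.Gamma (s - r))⁻¹ = falling r (s - 1) * (Complex.Gamma s)⁻¹ := by
  induction r with
  | zero => rw [Nat.cast_zero, sub_zero, falling_zero, one_mul]
  | succ r ih =>
    rw [Complex.one_div_Gamma_eq_self_mul_one_div_Gamma_add_one,
      show s - ((r + 1 : ℕ) : ℂ) + 1 = s - r by push_cast; ring, ih, falling_succ]
    push_cast
    ring

theorem Gamma_sub_natCast_mul_inv_Gamma {s : ℂ} {r : ℕ} (h : Complex.Gamma (s - r) ≠ 0) :
    Complex.Gamma (s - r) * (Complex.Gamma s)⁻¹ = (falling r (s - 1))⁻¹ := by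
  refine eq_inv_of_mul_eq_one_left ?_
  rw [mul_assoc, mul_comm _ (falling r (s - 1)), ← inv_Gamma_sub_natCast, mul_inv_cancel₀ h]

theorem Gamma_mul_inv_Gamma_sub_add {s : ℂ} (hs : Complex.Gamma s ≠ 0) {m N : ℕ} (hm : m ≤ N) :
    Complex.Gamma s * (Complex.Gamma (s - N + m))⁻¹ = falling (N - m) (s - 1) := by
  rw [show s - N + m = s - ((N - m : ℕ) : ℂ) by rw [Nat.cast_sub hm]; ring,
    inv_Gamma_sub_natCast, mul_left_comm, mul_inv_cancel₀ hs, mul_one]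

theorem Gamma_sub_mul_inv_Gamma_sub {s t : ℂ} (hst : s.im ≠ t.im) {m k : ℕ} (hm : m ≤ k) :
    Complex.Gamma (s - t + m - 1) * (Complex.Gamma (s - t + k))⁻¹ =
      (falling (k - m + 1) (s - 1 + k - t))⁻¹ := by
  have h_shift : s - t + m - 1 = s - t + k - ((k - m + 1 : ℕ) : ℂ) := by
    push_cast [Nat.cast_sub hm]
    ring
  have h_Gamma : Complex.Gamma (s - t + m - 1) ≠ 0 := Complex.Gamma_ne_zero fun i hi => hst <| by
    simpa [sub_eq_zero] using congr_arg Complex.im hi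
  rw [h_shift] at h_Gamma ⊢
  rw [Gamma_sub_natCast_mul_inv_Gamma h_Gamma, show s - t + k - 1 = s - 1 + k - t by ring]

theorem Gamma_sub_add_one_mul_inv_Gamma {t : ℂ} {N : ℕ} (ht : ∀ i : ℕ, t ≠ -((i : ℂ) + 1))
    (htN : ∀ n < N, t ≠ (n : ℂ)) :
    Complex.Gamma (t - N + 1) * (Complex.Gamma (t + 1))⁻¹ =
      (∏ j ∈ Finset.range N, (t - j))⁻¹ := by
  have h_Gamma : Complex.Gamma (t + 1 - N) ≠ 0 := by
    refine Complex.Gamma_ne_zero fun i hi => ?_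
    obtain h | h := lt_or_ge i N
    · refine htN (N - 1 - i) (by lia) ?_
      have h_cast : ((N - 1 - i : ℕ) : ℂ) + i + 1 = N := by
        exact_mod_cast (by lia : N - 1 - i + i + 1 = N)
      linear_combination hi - h_cast
    · refine ht (i - N) ?_
      rw [Nat.cast_sub h]
      linear_combination hi
  rw [show t - N + 1 = t + 1 - N by ring, Gamma_sub_natCast_mul_inv_Gamma h_Gamma,
    add_sub_cancel_right, falling_eq_prod]

/-- The part of the integrand that depends on `t` only, without its poles at `0, …, N - 1`. -/
def outerFactor (ν : ℕ) (μ x : ℝ) (t : ℂ) : ℂ :=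
  regHyp0F1 ((delta μ ^ 2 * x : ℝ) : ℂ) (t + 1) * (Complex.Gamma (t + ν + 1))⁻¹ *
    ((1 - delta μ ^ 2 / alpha μ ^ 2 : ℝ) : ℂ) ^ ν *
    ((alpha μ ^ 2 - delta μ ^ 2 : ℝ) : ℂ) ^ (t + 1) * (x : ℂ) ^ t

theorem differentiable_outerFactor (ν : ℕ) {μ x : ℝ} (hμ : 0 < μ) (hx : 0 < x) :
    Differentiable ℂ (outerFactor ν μ x) := by
  have h_hyp : Differentiable ℂ fun t : ℂ => regHyp0F1 ((delta μ ^ 2 * x : ℝ) : ℂ) (t + 1) :=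
    (differentiable_regHyp0F1 _).comp (differentiable_id.add_const 1)
  have h_Gamma : Differentiable ℂ fun t : ℂ => (Complex.Gamma (t + ν + 1))⁻¹ :=
    Complex.differentiable_one_div_Gamma.comp
      ((differentiable_id.add_const (ν : ℂ)).add_const 1)
  have h_base : Differentiable ℂ fun t : ℂ =>
      ((alpha μ ^ 2 - delta μ ^ 2 : ℝ) : ℂ) ^ (t + 1) := fun t =>
    (differentiableAt_id.add_const 1).const_cpow
      (Or.inl (Complex.ofReal_ne_zero.2 (alpha_sq_sub_delta_sq_pos hμ).ne'))
  have h_x : Differentiable ℂ fun t : ℂ => (x : ℂ) ^ t := fun t =>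
    differentiableAt_id.const_cpow (Or.inl (Complex.ofReal_ne_zero.2 hx.ne'))
  exact (((h_hyp.mul h_Gamma).mul_const _).mul h_base).mul h_x

theorem outerFactor_natCast_mul_nodalWeight {N n : ℕ} (hn : n < N) (ν : ℕ) {μ x : ℝ}
    (hδ : delta μ ≠ 0) (hx : 0 < x) :
    outerFactor ν μ x n * Lagrange.nodalWeight (Finset.range N) (fun i : ℕ => (i : ℂ)) n =
      residueConst N ν μ n * psi μ n x := by
  have h := pow_mul_regHyp0F1 hδ n hx
  rw [nodalWeight_range_natCast hn, outerFactor, residueConst, Complex.cpow_natCast,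
    show (n : ℂ) + ν + 1 = ((n + ν : ℕ) : ℂ) + 1 by push_cast; ring,
    Complex.Gamma_nat_eq_factorial, show (n : ℂ) + 1 = ((n + 1 : ℕ) : ℂ) by push_cast; ring,
    Complex.cpow_natCast]
  push_cast at h ⊢
  simp only [mul_inv]
  linear_combination ((n + ν)! : ℂ)⁻¹ *
    (1 - (delta μ : ℂ) ^ 2 / (alpha μ : ℂ) ^ 2) ^ ν *
    ((alpha μ : ℂ) ^ 2 - (delta μ : ℂ) ^ 2) ^ (n + 1) *
    (((-1) ^ (N - 1 - n))⁻¹ * ((n ! : ℂ)⁻¹ * ((N - 1 - n)! : ℂ)⁻¹)) * h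

/-- The part of the integrand that depends on `s`; the parameter `r` stands for `α² y`. -/
def innerFactor (N κ k m : ℕ) (r : ℝ) (t s : ℂ) : ℂ :=
  falling (N - m) (s - 1) * barnesWeight κ r s * (falling (k - m + 1) (s - 1 + k - t))⁻¹

theorem kernelIntegrand_eq {N ν k m : ℕ} {μ x y : ℝ} {t s : ℂ} (hmk : m ≤ k) (hmN : m ≤ N)
    (hs : 0 < s.re) (ht : ∀ i : ℕ, t ≠ -((i : ℂ) + 1)) (htN : ∀ n < N, t ≠ (n : ℂ))
    (hst : s.im ≠ t.im) :
    kernelIntegrand N ν μ k m x y t s =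
      outerFactor ν μ x t * (∏ j ∈ Finset.range N, (t - j))⁻¹ *
        innerFactor N (k + ν) k m (alpha μ ^ 2 * y) t s := by
  have h_hyp := hyp0F1_mul_inv_Gamma (b := t + 1) (fun i hi => ht i (by linear_combination hi))
    ((delta μ ^ 2 * x : ℝ) : ℂ)
  rw [kernelIntegrand, outerFactor, innerFactor, barnesWeight,
    ← Gamma_mul_inv_Gamma_sub_add (Complex.Gamma_ne_zero_of_re_pos hs) hmN,
    ← Gamma_sub_mul_inv_Gamma_sub hst hmk, ← Gamma_sub_add_one_mul_inv_Gamma ht htN, ← h_hyp,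
    add_comm k ν, Nat.cast_add, ← add_assoc s]
  simp only [div_eq_mul_inv, mul_inv]
  ring

theorem kernelIntegrand_eq_zero {N ν k m : ℕ} {μ x y : ℝ} {t : ℂ} {i : ℕ}
    (ht : t = -((i : ℂ) + 1)) (s : ℂ) : kernelIntegrand N ν μ k m x y t s = 0 := by
  have h_Gamma : Complex.Gamma (t + 1) = 0 := by
    rw [ht, neg_add, neg_add_cancel_right]
    exact Complex.Gamma_neg_nat_eq_zero i
  simp only [kernelIntegrand, h_Gamma, zero_pow two_ne_zero, zero_mul, div_zero]

/-! ### Holomorphic dependence of the inner integral on the outer variable -/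

theorem aestronglyMeasurable_deriv_of_forall_mem {α E : Type*} [MeasurableSpace α] {μ : Measure α}
    [NormedAddCommGroup E] [NormedSpace ℂ E] {F : ℂ → α → E} {U : Set ℂ} (hU : IsOpen U)
    (h_meas : ∀ t ∈ U, AEStronglyMeasurable (F t) μ)
    (h_diff : ∀ᵐ a ∂μ, DifferentiableOn ℂ (fun t => F t a) U) {t₀ : ℂ} (ht₀ : t₀ ∈ U) :
    AEStronglyMeasurable (fun a => deriv (fun t => F t a) t₀) μ := by
  have h_mem : ∀ᶠ t in 𝓝[≠] t₀, t ∈ U := mem_nhdsWithin_of_mem_nhds (hU.mem_nhds ht₀)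
  obtain ⟨u, hu, huU⟩ := exists_seq_forall_of_frequently h_mem.frequently
  refine aestronglyMeasurable_of_tendsto_ae atTop
    (f := fun n a => slope (fun t => F t a) t₀ (u n)) (fun n => ?_) ?_
  · simp only [slope_def_module]
    exact ((h_meas _ (huU n)).sub (h_meas _ ht₀)).const_smul _
  · filter_upwards [h_diff] with a ha
    exact (hasDerivAt_iff_tendsto_slope.1
      (ha.differentiableAt (hU.mem_nhds ht₀)).hasDerivAt).comp hu

theorem norm_deriv_le_of_mem_ball {E : Type*} [NormedAddCommGroup E] [NormedSpace ℂ E] {f : ℂ → E}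
    {t₀ t : ℂ} {ε B : ℝ} (hf : DifferentiableOn ℂ f (Metric.ball t₀ (2 * ε)))
    (hB : ∀ z ∈ Metric.ball t₀ (2 * ε), ‖f z‖ ≤ B) (ht : t ∈ Metric.ball t₀ (ε / 2))
    (hε : 0 < ε) : ‖deriv f t‖ ≤ B / ε := by
  have h_subset : Metric.closedBall t ε ⊆ Metric.ball t₀ (2 * ε) :=
    Metric.closedBall_subset_ball' (by linarith [Metric.mem_ball.1 ht])
  exact Complex.norm_deriv_le_of_forall_mem_sphere_norm_le hε
    ((hf.mono h_subset).diffContOnCl_ball subset_rfl)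
    fun z hz => hB z (h_subset (Metric.sphere_subset_closedBall hz))

theorem differentiableAt_integral_of_dominated {α E : Type*} [MeasurableSpace α] {μ : Measure α}
    [NormedAddCommGroup E] [NormedSpace ℂ E] {F : ℂ → α → E} {t₀ : ℂ} {ε : ℝ} (hε : 0 < ε)
    (h_meas : ∀ t ∈ Metric.ball t₀ ε, AEStronglyMeasurable (F t) μ)
    (h_diff : ∀ᵐ a ∂μ, DifferentiableOn ℂ (fun t => F t a) (Metric.ball t₀ ε)) {B : α → ℝ}
    (h_bound : ∀ᵐ a ∂μ, ∀ t ∈ Metric.ball t₀ ε, ‖F t a‖ ≤ B a) (hB : Integrable B μ) :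
    DifferentiableAt ℂ (fun t => ∫ a, F t a ∂μ) t₀ := by
  obtain ⟨η, rfl⟩ : ∃ η, ε = 2 * η := ⟨ε / 2, by ring⟩
  have hη : 0 < η := by linarith
  have ht₀ : t₀ ∈ Metric.ball t₀ (2 * η) := Metric.mem_ball_self hε
  have h_subset : Metric.ball t₀ (η / 2) ⊆ Metric.ball t₀ (2 * η) :=
    Metric.ball_subset_ball (by linarith)
  refine (hasDerivAt_integral_of_dominated_loc_of_deriv_le (F := F)
    (F' := fun t a => deriv (fun z => F z a) t) (bound := fun a => B a / η)
    (Metric.ball_mem_nhds t₀ (half_pos hη)) ?_ ?_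
    (aestronglyMeasurable_deriv_of_forall_mem Metric.isOpen_ball h_meas h_diff ht₀)
    ?_ (hB.div_const η) ?_).2.differentiableAt
  · exact eventually_of_mem (Metric.ball_mem_nhds t₀ hε) h_meas
  · exact hB.mono' (h_meas t₀ ht₀) (h_bound.mono fun a ha => ha t₀ ht₀)
  · filter_upwards [h_diff, h_bound] with a ha_diff ha_bound t ht
    exact norm_deriv_le_of_mem_ball ha_diff ha_bound ht hη
  · filter_upwards [h_diff] with a ha t ht
    exact (ha.differentiableAt (Metric.isOpen_ball.mem_nhds (h_subset ht))).hasDerivAt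

theorem differentiableOn_integral_of_norm_le_mul {α E E' : Type*} [MeasurableSpace α]
    {μ : Measure α} [NormedAddCommGroup E] [NormedSpace ℂ E] [NormedAddCommGroup E']
    {F : ℂ → α → E} {U : Set ℂ} (hU : IsOpen U) (h_meas : ∀ t ∈ U, AEStronglyMeasurable (F t) μ)
    (h_diff : ∀ᵐ a ∂μ, DifferentiableOn ℂ (fun t => F t a) U) {g : ℂ → ℝ}
    (hg : ContinuousOn g U) {G : α → E'} (hG : Integrable G μ)
    (h_bound : ∀ᵐ a ∂μ, ∀ t ∈ U, ‖F t a‖ ≤ g t * ‖G a‖) :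
    DifferentiableOn ℂ (fun t => ∫ a, F t a ∂μ) U := by
  intro t₀ ht₀
  have h_near : ∀ᶠ t in 𝓝 t₀, t ∈ U ∧ g t < g t₀ + 1 :=
    (hU.eventually_mem ht₀).and
      ((hg.continuousAt (hU.mem_nhds ht₀)).eventually (gt_mem_nhds (lt_add_one _)))
  obtain ⟨ε, hε, h_ball⟩ := Metric.eventually_nhds_iff_ball.1 h_near
  refine (differentiableAt_integral_of_dominated hε (fun t ht => h_meas t (h_ball t ht).1)
    (h_diff.mono fun a ha => ha.mono fun t ht => (h_ball t ht).1) ?_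
    (hG.norm.const_mul (g t₀ + 1))).differentiableWithinAt
  filter_upwards [h_bound] with a ha t ht
  exact (ha t (h_ball t ht).1).trans
    (mul_le_mul_of_nonneg_right (h_ball t ht).2.le (norm_nonneg _))

theorem abs_falling_re_le_norm_falling (r : ℕ) (a : ℂ) : |falling r a.re| ≤ ‖falling r a‖ := by
  rw [falling_eq_prod, falling_eq_prod, Finset.abs_prod, norm_prod]
  refine Finset.prod_le_prod (fun i _ => abs_nonneg _) fun i _ => ?_
  simpa only [Complex.sub_re, Complex.natCast_re] using Complex.abs_re_le_norm (a - i)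

theorem falling_ne_zero_of_falling_re_ne_zero {r : ℕ} {a : ℂ} (h : falling r a.re ≠ 0) :
    falling r a ≠ 0 :=
  norm_pos_iff.1 ((abs_pos.2 h).trans_le (abs_falling_re_le_norm_falling r a))

theorem falling_sub_re_ne_zero {k : ℕ} (m : ℕ) {c : ℝ} {t : ℂ}
    (ht : ∀ j ≤ k, t.re ≠ c + j - 1) : falling (k - m + 1) (c - 1 + k - t.re) ≠ 0 := by
  rw [falling_eq_prod, Finset.prod_ne_zero_iff]
  intro i hi h_zero
  have h_le : i ≤ k := by
    have := Finset.mem_range.1 hi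
    lia
  refine ht (k - i) (Nat.sub_le k i) ?_
  rw [Nat.cast_sub h_le]
  linear_combination -h_zero

section InnerFactor

variable {N κ k m : ℕ} {c r : ℝ} {t s : ℂ}

theorem re_sub_one_add_natCast_sub (hs : s.re = c) : (s - 1 + k - t).re = c - 1 + k - t.re := by
  simp only [Complex.sub_re, Complex.add_re, Complex.one_re, Complex.natCast_re, hs]

theorem norm_inv_falling_le (hs : s.re = c) (ht : ∀ j ≤ k, t.re ≠ c + j - 1) :
    ‖(falling (k - m + 1) (s - 1 + k - t))⁻¹‖ ≤ |falling (k - m + 1) (c - 1 + k - t.re)|⁻¹ := by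
  rw [norm_inv, ← re_sub_one_add_natCast_sub hs]
  refine inv_anti₀ (abs_pos.2 ?_) (abs_falling_re_le_norm_falling _ _)
  rw [re_sub_one_add_natCast_sub hs]
  exact falling_sub_re_ne_zero m ht

theorem falling_sub_ne_zero (hs : s.re = c) (ht : ∀ j ≤ k, t.re ≠ c + j - 1) :
    falling (k - m + 1) (s - 1 + k - t) ≠ 0 := by
  refine falling_ne_zero_of_falling_re_ne_zero ?_
  rw [re_sub_one_add_natCast_sub hs]
  exact falling_sub_re_ne_zero m ht

theorem continuous_falling {𝕜 : Type*} [NormedField 𝕜] (r : ℕ) :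
    Continuous (falling r : 𝕜 → 𝕜) :=
  (descPochhammer 𝕜 r).continuous

theorem integrable_falling_mul_barnesWeight (n κ : ℕ) (hc : 0 < c) (hr : 0 < r) :
    Integrable fun v : ℝ => falling n ((c : ℂ) + v * Complex.I - 1) *
      barnesWeight κ r (c + v * Complex.I) := by
  have h := integrable_eval_mul_barnesWeight
    ((descPochhammer ℂ n).comp (Polynomial.X - 1)) κ hc hr
  simp only [Polynomial.eval_comp, Polynomial.eval_sub, Polynomial.eval_X,
    Polynomial.eval_one] at h
  exact h

theorem integrable_innerFactor (N κ m : ℕ) (hc : 0 < c) (hr : 0 < r)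
    (ht : ∀ j ≤ k, t.re ≠ c + j - 1) :
    Integrable fun v : ℝ => innerFactor N κ k m r t (c + v * Complex.I) := by
  refine (integrable_falling_mul_barnesWeight (N - m) κ hc hr).mul_bdd
    (Continuous.aestronglyMeasurable ?_)
    (ae_of_all _ fun v => norm_inv_falling_le (re_add_mul_I c v) ht)
  exact ((continuous_falling _).comp (by fun_prop)).inv₀ fun v =>
    falling_sub_ne_zero (re_add_mul_I c v) ht

theorem differentiableOn_innerFactor (N κ m : ℕ) (r : ℝ) (hs : s.re = c) {U : Set ℂ}
    (hU : ∀ t ∈ U, ∀ j ≤ k, t.re ≠ c + j - 1) :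
    DifferentiableOn ℂ (fun t => innerFactor N κ k m r t s) U := by
  refine DifferentiableOn.const_mul ?_ _
  exact ((descPochhammer ℂ (k - m + 1)).differentiable.comp
    (differentiable_id.const_sub _)).differentiableOn.inv fun t ht =>
      falling_sub_ne_zero hs (hU t ht)

theorem differentiableOn_verticalIntegral_innerFactor (N κ m : ℕ) (hc : 0 < c) (hr : 0 < r)
    {U : Set ℂ} (hUo : IsOpen U) (hU : ∀ t ∈ U, ∀ j ≤ k, t.re ≠ c + j - 1) :
    DifferentiableOn ℂ (fun t => verticalIntegral c (innerFactor N κ k m r t)) U := by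
  have h_cont : ContinuousOn (fun t : ℂ => |falling (k - m + 1) (c - 1 + k - t.re)|⁻¹) U := by
    refine ((continuous_falling _).comp (by fun_prop)).abs.continuousOn.inv₀ fun t ht => ?_
    exact abs_ne_zero.2 (falling_sub_re_ne_zero m (hU t ht))
  refine DifferentiableOn.const_mul (differentiableOn_integral_of_norm_le_mul hUo
    (fun t ht => (integrable_innerFactor N κ m hc hr (hU t ht)).aestronglyMeasurable)
    (ae_of_all _ fun v => differentiableOn_innerFactor N κ m r (re_add_mul_I c v) hU) h_cont
    (integrable_falling_mul_barnesWeight (N - m) κ hc hr) (ae_of_all _ fun v t ht => ?_)) _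
  rw [innerFactor, norm_mul, mul_comm]
  exact mul_le_mul_of_nonneg_right (norm_inv_falling_le (re_add_mul_I c v) (hU t ht))
    (norm_nonneg _)

end InnerFactor

/-! ### The double contour integral -/

/-- The inner integral of `kernelIntegrand` as a function of `t`, without its poles at
`0, …, N - 1`. -/
def regularPart (N ν : ℕ) (μ c : ℝ) (k m : ℕ) (x y : ℝ) (t : ℂ) : ℂ :=
  outerFactor ν μ x t * verticalIntegral c (innerFactor N (k + ν) k m (alpha μ ^ 2 * y) t)

section DoubleContourIntegral

variable {N k m : ℕ} (ν : ℕ) {μ c x y : ℝ}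

theorem differentiableOn_regularPart (N m : ℕ) (hμ : 0 < μ) (hc : 0 < c) (hx : 0 < x) (hy : 0 < y)
    {U : Set ℂ} (hUo : IsOpen U) (hU : ∀ t ∈ U, ∀ j ≤ k, t.re ≠ c + j - 1) :
    DifferentiableOn ℂ (regularPart N ν μ c k m x y) U :=
  (differentiable_outerFactor ν hμ hx).differentiableOn.mul
    (differentiableOn_verticalIntegral_innerFactor N (k + ν) m hc
      (mul_pos (pow_pos (alpha_pos hμ) 2) hy) hUo hU)

theorem kernelIntegrand_ae_eq (hmk : m ≤ k) (hmN : m ≤ N) (hc : 0 < c) {t : ℂ}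
    (ht : ∀ i : ℕ, t ≠ -((i : ℂ) + 1)) (htN : ∀ n < N, t ≠ n) :
    (fun v : ℝ => kernelIntegrand N ν μ k m x y t (c + v * Complex.I)) =ᵐ[volume]
      fun v : ℝ => outerFactor ν μ x t * (∏ j ∈ Finset.range N, (t - j))⁻¹ *
        innerFactor N (k + ν) k m (alpha μ ^ 2 * y) t (c + v * Complex.I) := by
  filter_upwards [(countable_singleton t.im).ae_notMem volume] with v hv
  refine kernelIntegrand_eq hmk hmN ?_ ht htN ?_
  · rwa [re_add_mul_I]
  · simpa using hv

theorem verticalIntegral_kernelIntegrand (hmk : m ≤ k) (hmN : m ≤ N) (hc : 0 < c) {t : ℂ}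
    (ht : ∀ i : ℕ, t ≠ -((i : ℂ) + 1)) (htN : ∀ n < N, t ≠ n) :
    verticalIntegral c (fun s => kernelIntegrand N ν μ k m x y t s) =
      regularPart N ν μ c k m x y t * (∏ j ∈ Finset.range N, (t - j))⁻¹ := by
  rw [regularPart, mul_right_comm, ← verticalIntegral_const_mul]
  exact verticalIntegral_congr_ae (kernelIntegrand_ae_eq ν hmk hmN hc ht htN)

theorem integrable_kernelIntegrand (hμ : 0 < μ) (hmk : m ≤ k) (hmN : m ≤ N) (hc : 0 < c)
    (x : ℝ) (hy : 0 < y) {t : ℂ} (htN : ∀ n < N, t ≠ n) (ht : ∀ j ≤ k, t.re ≠ c + j - 1) :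
    Integrable fun v : ℝ => kernelIntegrand N ν μ k m x y t (c + v * Complex.I) := by
  by_cases h_pole : ∃ i : ℕ, t = -((i : ℂ) + 1)
  · obtain ⟨i, hi⟩ := h_pole
    simp_rw [kernelIntegrand_eq_zero hi]
    exact integrable_zero _ _ _
  · exact ((integrable_innerFactor N (k + ν) m hc (mul_pos (pow_pos (alpha_pos hμ) 2) hy)
      ht).const_mul _).congr
        (kernelIntegrand_ae_eq ν hmk hmN hc (not_exists.1 h_pole) htN).symm

theorem sum_verticalIntegral_innerFactor {n : ℕ} (hn : n < N) (hk : k < N) (κ : ℕ) (hc : 0 < c)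
    {r : ℝ} (hr : 0 < r) (h_sep : ∀ j ≤ k, (n : ℝ) ≠ c + j - 1) :
    ∑ m ∈ Finset.range (k + 1), (-1) ^ m * (N.choose m : ℂ) *
        verticalIntegral c (innerFactor N κ k m r n) =
      verticalIntegral c fun s => (residuePoly ℂ N n k).eval (s - 1) * barnesWeight κ r s := by
  have h_sep' : ∀ j ≤ k, (n : ℂ).re ≠ c + j - 1 := by simpa only [Complex.natCast_re] using h_sep
  simp_rw [← verticalIntegral_const_mul]
  rw [← verticalIntegral_finset_sum]
  · refine verticalIntegral_congr fun s hs => ?_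
    have h_pos : ∀ i < k, s - 1 + i + 1 ≠ 0 := fun i _ h => by
      have h_re := congr_arg Complex.re h
      simp only [Complex.add_re, Complex.sub_re, Complex.one_re, Complex.natCast_re,
        Complex.zero_re, hs] at h_re
      linarith [i.cast_nonneg (α := ℝ)]
    have h_ne : ∀ j ≤ k, s - 1 - n + j ≠ 0 := fun j hj h => by
      have h_re := congr_arg Complex.re h
      simp only [Complex.add_re, Complex.sub_re, Complex.one_re, Complex.natCast_re,
        Complex.zero_re, hs] at h_re
      exact h_sep j hj (by linarith)
    rw [eval_residuePoly hn hk h_pos h_ne, Finset.sum_mul]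
    refine Finset.sum_congr rfl fun m _ => ?_
    rw [innerFactor]
    ring
  · exact fun m _ => (integrable_innerFactor N κ m hc hr h_sep').const_mul _

variable {p : ℂ} {γ : Path p p}

theorem exists_convex_isOpen_re_ne (γ : Path p p)
    (h_sep : ∀ j < N, ∀ u, (γ u).re ≠ c + j - 1) :
    ∃ U : Set ℂ, Convex ℝ U ∧ IsOpen U ∧ range γ ⊆ U ∧ ∀ t ∈ U, ∀ j < N, t.re ≠ c + j - 1 := by
  have h_open : IsOpen {r : ℝ | ∀ j < N, r ≠ c + j - 1} := by
    simp only [ofPred_forall]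
    exact (finite_lt_nat N).isOpen_biInter fun j _ => isOpen_ne
  exact exists_convex_isOpen_of_re_mem γ h_open fun u j hj => h_sep j hj u

theorem curveIntegrable_verticalIntegral_kernelIntegrand (hμ : 0 < μ) (hγ : IsPiecewiseC1 γ)
    (hγN : ∀ n : ℕ, n < N → EncirclesOnce γ n) (hc : 0 < c)
    (h_sep : ∀ j < N, ∀ u, (γ u).re ≠ c + j - 1) (hx : 0 < x) (hy : 0 < y) (hk : k < N)
    (hmk : m ≤ k) :
    CurveIntegrable
      (oneForm fun t => verticalIntegral c fun s => kernelIntegrand N ν μ k m x y t s) γ := by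
  obtain ⟨U, -, hUo, hγU, hU⟩ := exists_convex_isOpen_re_ne γ h_sep
  have h_regular : ContinuousOn (regularPart N ν μ c k m x y) (range γ) :=
    ((differentiableOn_regularPart ν N m hμ hc hx hy hUo fun t ht j hj =>
      hU t ht j (hj.trans_lt hk)).continuousOn).mono hγU
  have h_poles : ContinuousOn (fun t : ℂ => (∏ j ∈ Finset.range N, (t - j))⁻¹) (range γ) :=
    ContinuousOn.inv₀ (by fun_prop) fun t ht => Finset.prod_ne_zero_iff.2 fun n hn =>
      sub_ne_zero.2 ((hγN n (Finset.mem_range.1 hn)).ne ht)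
  exact curveIntegrable_congr (countable_range fun i : ℕ => -((i : ℂ) + 1))
    (fun t ht htZ => verticalIntegral_kernelIntegrand ν hmk (hmk.trans hk.le) hc
      (fun i hi => htZ ⟨i, hi.symm⟩) fun n hn => (hγN n hn).ne ht)
    (hγ.curveIntegrable (h_regular.mul h_poles))

theorem contourIntegral_verticalIntegral_kernelIntegrand (hμ : 0 < μ) (hμ_one : μ ≠ 1)
    (hγ : IsPiecewiseC1 γ) (hγN : ∀ n : ℕ, n < N → EncirclesOnce γ n) (hc : 0 < c)
    (h_sep : ∀ j < N, ∀ u, (γ u).re ≠ c + j - 1) (hx : 0 < x) (hy : 0 < y) (hk : k < N)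
    (hmk : m ≤ k) :
    contourIntegral γ (fun t => verticalIntegral c fun s => kernelIntegrand N ν μ k m x y t s) =
      2 * Real.pi * Complex.I * ∑ n ∈ Finset.range N, residueConst N ν μ n * psi μ n x *
        verticalIntegral c (innerFactor N (k + ν) k m (alpha μ ^ 2 * y) n) := by
  obtain ⟨U, hU_convex, hUo, hγU, hU⟩ := exists_convex_isOpen_re_ne γ h_sep
  rw [contourIntegral_congr (countable_range fun i : ℕ => -((i : ℂ) + 1)) fun t ht htZ =>
      verticalIntegral_kernelIntegrand ν hmk (hmk.trans hk.le) hc (fun i hi => htZ ⟨i, hi.symm⟩)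
        fun n hn => (hγN n hn).ne ht,
    contourIntegral_mul_inv_prod hγ hU_convex hUo hγU
      (Finset.nonempty_range_iff.2 (Nat.ne_zero_of_lt hk)) Nat.cast_injective.injOn
      (fun n hn => hγN n (Finset.mem_range.1 hn))
      (differentiableOn_regularPart ν N m hμ hc hx hy hUo fun t ht j hj =>
        hU t ht j (hj.trans_lt hk))]
  congr 1
  refine Finset.sum_congr rfl fun n hn => ?_
  rw [← outerFactor_natCast_mul_nodalWeight (Finset.mem_range.1 hn) ν (delta_ne_zero hμ hμ_one) hx,
    regularPart, mul_right_comm]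

theorem kernelCoeff_eq (hμ : 0 < μ) (hμ_one : μ ≠ 1) (hγ : IsPiecewiseC1 γ)
    (hγN : ∀ n : ℕ, n < N → EncirclesOnce γ n) (hc : 0 < c)
    (h_sep : ∀ j < N, ∀ u, (γ u).re ≠ c + j - 1) (hx : 0 < x) (hy : 0 < y) (hk : k < N) :
    kernelCoeff N ν μ γ c k x y = (2 * Real.pi * Complex.I)⁻¹ * ∑ n ∈ Finset.range N,
      residueConst N ν μ n * psi μ n x * verticalIntegral c fun s =>
        (residuePoly ℂ N n k).eval (s - 1) * barnesWeight (k + ν) (alpha μ ^ 2 * y) s := by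
  obtain ⟨U, hU_convex, hUo, hγU, hU⟩ := exists_convex_isOpen_re_ne γ h_sep
  have h_residues : ∀ m ∈ Finset.range (k + 1),
      (-1) ^ m / (2 * Real.pi * Complex.I) ^ 2 * (N.choose m : ℂ) *
        contourIntegral γ (fun t => verticalIntegral c fun s => kernelIntegrand N ν μ k m x y t s) =
      (2 * Real.pi * Complex.I)⁻¹ * ∑ n ∈ Finset.range N, residueConst N ν μ n * psi μ n x *
        ((-1) ^ m * (N.choose m : ℂ) *
          verticalIntegral c (innerFactor N (k + ν) k m (alpha μ ^ 2 * y) n)) := fun m hm => by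
    rw [contourIntegral_verticalIntegral_kernelIntegrand ν hμ hμ_one hγ hγN hc h_sep hx hy hk
      (Finset.mem_range_succ_iff.1 hm), Finset.mul_sum, Finset.mul_sum, Finset.mul_sum]
    refine Finset.sum_congr rfl fun n _ => ?_
    have h_ne := Complex.two_pi_I_ne_zero
    generalize 2 * (Real.pi : ℂ) * Complex.I = z at *
    field_simp
  rw [kernelCoeff, Finset.sum_congr rfl h_residues, ← Finset.mul_sum, Finset.sum_comm]
  congr 1
  refine Finset.sum_congr rfl fun n hn => ?_
  have hn := Finset.mem_range.1 hn
  have h_mem : (n : ℂ) ∈ U := (hγN n hn).mem_of_convex hγ hU_convex hUo hγU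
  rw [← Finset.mul_sum, sum_verticalIntegral_innerFactor hn hk (k + ν) hc
    (mul_pos (pow_pos (alpha_pos hμ) 2) hy) fun j hj => ?_]
  simpa only [Complex.natCast_re] using hU n h_mem j (hj.trans_lt hk)

theorem sum_kernelCoeff_mul_pow (hμ : 0 < μ) (hμ_one : μ ≠ 1) (hγ : IsPiecewiseC1 γ)
    (hγN : ∀ n : ℕ, n < N → EncirclesOnce γ n) (hc : 0 < c)
    (h_sep : ∀ j < N, ∀ u, (γ u).re ≠ c + j - 1) (hx : 0 < x) (hy : 0 < y) :
    ∑ k ∈ Finset.range N,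
        kernelCoeff N ν μ γ c k x y * ((delta μ / alpha μ : ℝ) : ℂ) ^ (2 * k) =
      ∑ n ∈ Finset.range N, psi μ n x * dualFun N ν μ n c y := by
  have hr : 0 < alpha μ ^ 2 * y := mul_pos (pow_pos (alpha_pos hμ) 2) hy
  simp_rw [dualFun, verticalIntegral_mellinPoly_mul_barnesWeight N ν _ _ hc hr, Finset.mul_sum]
  rw [Finset.sum_comm]
  refine Finset.sum_congr rfl fun k hk => ?_
  rw [kernelCoeff_eq ν hμ hμ_one hγ hγN hc h_sep hx hy (Finset.mem_range.1 hk), Finset.mul_sum,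
    Finset.sum_mul, pow_mul]
  exact Finset.sum_congr rfl fun n _ => by ring

end DoubleContourIntegral

end CoupledGaussian

end

open CoupledGaussian in
theorem mainTheorem8_general (N ν : ℕ) (μ : ℝ) (hμ₀ : 0 < μ) (hμ₁ : μ ≠ 1)
    (p : ℂ) (γ : Path p p) (hγ : IsPiecewiseC1 γ)
    (hγN : ∀ n : ℕ, n < N → EncirclesOnce γ (n : ℂ))
    (c : ℝ) (hc : 0 < c)
    (hsep : ∀ j : ℕ, j < N → ∀ u, (γ u).re ≠ c + j - 1)
    (x y : ℝ) (hx : 0 < x) (hy : 0 < y) :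
    (∀ k : ℕ, k < N → ∀ m : ℕ, m ≤ k →
      (∀ u, MeasureTheory.Integrable
        (fun v : ℝ => kernelIntegrand N ν μ k m x y (γ u) (c + v * Complex.I))) ∧
      CurveIntegrable
        (oneForm fun t => verticalIntegral c fun s => kernelIntegrand N ν μ k m x y t s) γ) ∧
    (correlationKernel N ν μ x y : ℂ) =
      ∑ k ∈ Finset.range N,
        kernelCoeff N ν μ γ c k x y * ((delta μ / alpha μ : ℝ) : ℂ) ^ (2 * k) := by
  refine ⟨fun k hk m hmk => ⟨fun u => ?_, ?_⟩, ?_⟩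
  · exact integrable_kernelIntegrand ν hμ₀ hmk (hmk.trans hk.le) hc x hy
      (fun n hn => (hγN n hn).ne (Set.mem_range_self u)) fun j hj => hsep j (hj.trans_lt hk) u
  · exact curveIntegrable_verticalIntegral_kernelIntegrand ν hμ₀ hγ hγN hc hsep hx hy hk hmk
  · rw [correlationKernel_eq_sum_psi_mul_dualFun hμ₀ hμ₁ N ν hc x hy,
      sum_kernelCoeff_mul_pow ν hμ₀ hμ₁ hγ hγN hc hsep hx hy]

open CoupledGaussian in
theorem mainTheorem8 (N ν : ℕ) (μ : ℝ) (hμ₀ : 0 < μ) (hμ₁ : μ < 1)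
    (p : ℂ) (γ : Path p p) (hγ : IsPiecewiseC1 γ)
    (hγN : ∀ n : ℕ, n < N → EncirclesOnce γ (n : ℂ))
    (c : ℝ) (hc : 0 < c)
    (hsep : ∀ j : ℕ, j < N → ∀ u, (γ u).re ≠ c + j - 1)
    (x y : ℝ) (hx : 0 < x) (hy : 0 < y) :
    (∀ k : ℕ, k < N → ∀ m : ℕ, m ≤ k →
      (∀ u, MeasureTheory.Integrable
        (fun v : ℝ => kernelIntegrand N ν μ k m x y (γ u) (c + v * Complex.I))) ∧
      CurveIntegrable
        (oneForm fun t => verticalIntegral c fun s => kernelIntegrand N ν μ k m x y t s) γ) ∧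
    (correlationKernel N ν μ x y : ℂ) =
      ∑ k ∈ Finset.range N,
        kernelCoeff N ν μ γ c k x y * ((delta μ / alpha μ : ℝ) : ℂ) ^ (2 * k) := by
  exact mainTheorem8_general N ν μ hμ₀ hμ₁.ne p γ hγ hγN c hc hsep x y hx hy
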